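/- Let $\mathbb F$ be a field of characteristic $0$ and $\mathbb N=\{0,1,2,\dots\}$. **Conformal algebras.** A conformal algebra is an $\mathbb F[\partial]$-module $R$ with a linear map $Y^+(\cdot,z):R\to \mathrm{Hom}_{\mathbb F}(R,R[z^{-1}]z^{-1})$ such that, for all $u,v\in R$, $$Y^+(\partial u,z)=\tfrac{d}{dz}Y^+(u,z),\qquad Y^+(u,z)v=\mathrm{Res}_x\tfrac1{z-x}e^{x\partial}Y^+(v,-x)u,$$ $$Y^+(u,z_1)Y^+(v,z_2)-Y^+(v,z_2)Y^+(u,z_1)=\mathrm{Res}_x\tfrac1{z_2-x}Y^+(Y^+(u,z_1-x)v,x),$$ where $\mathrm{Res}_x$ takes the coefficient of $x^{-1}$ and negative powers of binomials are expanded in nonnegative powers of the second variable. A conformal subalgebra is a subspace closed under $\partial$ and under all coefficients of $Y^+$ (and is a conformal algebra under the restricted operations). An ideal is a subspace $I$ with $\partial I\subseteq I$ and $Y^+(u,z)I\subseteq I[z^{-1}]z^{-1}$ for all $u\in R$; $R$ is simple if $Y^+\neq 0$ and the only ideals are $0$ and $R$. With respect to a grading $R=\bigoplus_{n\in\mathbb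 N}R^{(n)}$ (put $R^{(n)}=0$ for $n<0$), $R$ is of finite growth if * for $u\in R^{(l)}$ one has $Y^+(u,z)=\sum_{j\ge 1-l}u(j)z^{-j-l}$ with $u(j)R^{(n)}\subseteq R^{(n-j)}$ for all $n$; and * $R$ is a free $\mathbb F[\partial]$-module over a graded subspace $V$, i.e. $\mathbb F[\partial]\otimes_{\mathbb F} V\to R$ is bijective, and $\dim (V\cap R^{(n)})\le N_0$ for all $n$ and some fixed $N_0$. **The matrix conformal algebra.** For $k\ge1$ let $\mathcal A=M_{k\times k}(\mathbb F)$, $R_{k\times k}=\mathcal A\otimes\mathbb F[t_1,t_2]$, $u(m,n)=u\otimes t_1^mt_2^n$, with the grading $R_{k\times k}^{(n)}=\mathrm{Span}\{u(m_1,m_2): u\in\mathcal A,\ m_1+m_2+1=n\}$ and the operations $$\partial(u(m,n))=(m+1)u(m+1,n)+(n+1)u(m,n+1),$$ $$Y^+(u(m_1,m_2),z)v(n_1,n_2)=\binom{-n_1-1}{m_2}\sum_{p=0}^{m_1+m_2+n_1}\binom p{m_1}(uv)(p,n_2)z^{p-m_1-m_2-n_1-1}-\binom{-n_2-1}{m_1}\sum_{q=0}^{m_1+m_2+n_2}\binom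 q{m_2}(vu)(n_1,q)z^{q-m_1-m_2-n_2-1}.$$ For $\ell\ge1$ write $s=\ell-1$ and set $$R_{k\times k,\ell}=\mathrm{Span}\{u(m,n+s): u\in\mathcal A,\ m,n\in\mathbb N\},$$ $$R^{*}_{k\times k,\ell}=\mathrm{Span}\Big\{\tbinom{n+s}{s}u(m,n+s)-(-1)^{s}\tbinom{m+s}{s}u^{T}(n,m+s): u\in\mathcal A,\ m,n\in\mathbb N\Big\},$$ and, for even $k=2k_1$, let $R^{\dagger}_{k\times k,\ell}$ be the span defined like $R^{*}_{k\times k,\ell}$ with $u^T$ replaced by $$u^{\dagger}=\begin{pmatrix}0&-I_{k_1}\\ I_{k_1}&0\end{pmatrix}u^T\begin{pmatrix}0&I_{k_1}\\ -I_{k_1}&0\end{pmatrix}.$$ **Theorem 4.1.** For every $k\ge1$, $(R_{k\times k},\partial,Y^+)$ is a conformal algebra. For every $\ell\ge1$ the subspaces $R_{k\times k,\ell}$ and $R^{*}_{k\times k,\ell}$ and, when $k$ is even, $R^{\dagger}_{k\times k,\ell}$ are conformal subalgebras of $R_{k\times k}$, and each of them, with the restricted operations and the induced grading $X^{(n)}=X\cap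 R_{k\times k}^{(n)}$, is a simple conformal algebra of finite growth. The minimal weight, i.e. the least $n$ with $X^{(n)}\ne0$, equals $\ell$ for $X=R_{k\times k,\ell}$, for $X=R^{\dagger}_{k\times k,\ell}$, and for $X=R^{*}_{k\times k,\ell}$ except in the degenerate case $k=1$, $\ell$ odd. -/

import Mathlib

open Finset
open scoped Nat

noncomputable section

namespace Conformal

/-! ### Conformal algebras

The space `R[z⁻¹]z⁻¹` is `ℕ →₀ R`: the finitely supported function `f` stands for
`∑ j, f j * z^(-j-1)`. So a structure map `Y⁺(·, z) : R → LM(R, R[z⁻¹]z⁻¹)` is a linear map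
`Y : R →ₗ[F] R →ₗ[F] (ℕ →₀ R)`, with `Y u v j = u_j v` in `Y⁺(u, z) v = ∑ j, u_j v z^(-j-1)`.
An `F[∂]`-module is a vector space with a linear endomorphism `d`. -/

section General

variable {F R : Type*} [Field F] [AddCommGroup R] [Module F R]

/-- The axioms of a conformal algebra, read off coefficient by coefficient. -/
structure IsConformalAlgebra (d : R →ₗ[F] R) (Y : R →ₗ[F] R →ₗ[F] (ℕ →₀ R)) : Prop where
  /-- `Y⁺(∂u, z) = d/dz Y⁺(u, z)`, the coefficient of `z⁻¹`. -/
  deriv_zero : ∀ u v, Y (d u) v 0 = 0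
  /-- `Y⁺(∂u, z) = d/dz Y⁺(u, z)`, the coefficient of `z^(-j-2)`. -/
  deriv_succ : ∀ u v j, Y (d u) v (j + 1) = -((j : F) + 1) • Y u v j
  /-- `Y⁺(u, z) v = Res_x (z - x)⁻¹ e^(x∂) Y⁺(v, -x) u`, the coefficient of `z^(-j-1)`. On the
  right `e^(x∂) Y⁺(v, -x) u` is the sum of `(-1)^(m+1) / i! * ∂^i (v_m u) * x^(i-m-1)`, and the
  residue keeps the terms with `i - m - 1 = - j - 1`. -/
  skew : ∀ u v j, Y u v j = (Y v u).sum fun m w =>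
    if j ≤ m then ((-1 : F) ^ (m + 1) * (((m - j)! : ℕ) : F)⁻¹) • (d ^ (m - j)) w else 0
  /-- `Y⁺(u, z₁) Y⁺(v, z₂) - Y⁺(v, z₂) Y⁺(u, z₁) = Res_x (z₂ - x)⁻¹ Y⁺(Y⁺(u, z₁ - x) v, x)`,
  the coefficient of `z₁^(-m-1) z₂^(-n-1)`. On the right `(z₁ - x)^(-i-1)` is expanded in powers
  of `x`; its term in `z₁^(-m-1)` is `(m choose i) x^(m-i) z₁^(-m-1)`. -/
  jacobi : ∀ u v w m n, Y u (Y v w n) m - Y v (Y u w m) n =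
    ∑ i ∈ range (m + 1), (m.choose i : F) • Y (Y u v i) w (m + n - i)

/-- An ideal: a subspace `I` with `∂ I ⊆ I` and `Y⁺(u, z) I ⊆ I[z⁻¹]z⁻¹` for all `u`. -/
structure IsIdeal (d : R →ₗ[F] R) (Y : R →ₗ[F] R →ₗ[F] (ℕ →₀ R)) (I : Submodule F R) : Prop where
  d_mem : ∀ v ∈ I, d v ∈ I
  Y_mem : ∀ u, ∀ v ∈ I, ∀ j, Y u v j ∈ I

/-- Simplicity: the structure map is not zero, and there is no proper nonzero ideal. -/
structure IsSimple (d : R →ₗ[F] R) (Y : R →ₗ[F] R →ₗ[F] (ℕ →₀ R)) : Prop where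
  nontrivial : ∃ u v, Y u v ≠ 0
  ideal : ∀ I : Submodule F R, IsIdeal d Y I → I = ⊥ ∨ I = ⊤

/-- `R = ⨁ gr n` is `ℕ`-weighted: for `u` of weight `l`, the coefficient of `z^(-j-l)` in
`Y⁺(u, z)` maps weight `n` to weight `n - j`. With `i = j + l - 1` this is the coefficient
of `z^(-i-1)`, and the target weight is `r = n + l - i - 1` (zero space if this is negative). -/
structure IsWeighted (Y : R →ₗ[F] R →ₗ[F] (ℕ →₀ R)) (gr : ℕ → Submodule F R) : Prop where
  internal : DirectSum.IsInternal gr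
  weight : ∀ l n i r, n + l = r + i + 1 → ∀ u ∈ gr l, ∀ v ∈ gr n, Y u v i ∈ gr r
  weight_neg : ∀ l n i, n + l < i + 1 → ∀ u ∈ gr l, ∀ v ∈ gr n, Y u v i = 0

/-- `R` is a free `F[∂]`-module over the subspace `V`: the natural map `F[∂] ⊗ V → R`, which
sends `∑ ∂ⁿ ⊗ vₙ` to `∑ ∂ⁿ vₙ`, is bijective. -/
def IsFreeOver (d : R →ₗ[F] R) (V : Submodule F R) : Prop :=
  Function.Bijective fun f : ℕ →₀ V => f.sum fun n v => (d ^ n) (v : R)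

/-- Finite growth with respect to the grading `gr`: `R` is `ℕ`-weighted and free over `F[∂]` on a
graded subspace `V` whose homogeneous parts have bounded dimension. -/
structure IsFiniteGrowth (d : R →ₗ[F] R) (Y : R →ₗ[F] R →ₗ[F] (ℕ →₀ R))
    (gr : ℕ → Submodule F R) : Prop where
  weighted : IsWeighted Y gr
  free : ∃ V : Submodule F R, V = ⨆ n, V ⊓ gr n ∧ IsFreeOver d V ∧
    ∃ N : ℕ, ∀ n, Module.rank F ↥(V ⊓ gr n) ≤ N

/-- The smallest weight `n` for which `X ∩ gr n` is not zero is `ℓ`. -/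
def HasMinimalWeight (gr : ℕ → Submodule F R) (X : Submodule F R) (ℓ : ℕ) : Prop :=
  IsLeast {n | X ⊓ gr n ≠ ⊥} ℓ

/-- The subspace `X` is closed under `∂` and under all coefficients of `Y⁺`. -/
structure IsClosedSubspace (d : R →ₗ[F] R) (Y : R →ₗ[F] R →ₗ[F] (ℕ →₀ R))
    (X : Submodule F R) : Prop where
  d_mem : ∀ u ∈ X, d u ∈ X
  Y_mem : ∀ u ∈ X, ∀ v ∈ X, ∀ j, Y u v j ∈ X

namespace IsClosedSubspace

variable {d : R →ₗ[F] R} {Y : R →ₗ[F] R →ₗ[F] (ℕ →₀ R)} {X : Submodule F R}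

/-- The restriction of `∂` to `X`. -/
def resD (h : IsClosedSubspace d Y X) : X →ₗ[F] X :=
  d.restrict h.d_mem

/-- The restriction of `Y⁺` to `X`. -/
def resY (h : IsClosedSubspace d Y X) : X →ₗ[F] X →ₗ[F] (ℕ →₀ X) :=
  LinearMap.mk₂ F
    (fun u v => Finsupp.onFinset (Y u v).support
      (fun j => (⟨Y u v j, h.Y_mem u u.2 v v.2 j⟩ : X))
      (fun j hj => by
        rw [Finsupp.mem_support_iff]
        intro h0
        exact hj (Subtype.ext h0)))
    (fun u u' v => by ext j; simp)
    (fun c u v => by ext j; simp)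
    (fun u v v' => by ext j; simp)
    (fun c u v => by ext j; simp)

theorem resD_coe (h : IsClosedSubspace d Y X) (u : X) : (h.resD u : R) = d u := rfl

theorem resY_coe (h : IsClosedSubspace d Y X) (u v : X) (j : ℕ) :
    (h.resY u v j : R) = Y u v j := rfl

end IsClosedSubspace

/-- The grading that a subspace `X` inherits: `X ∩ gr n`, as a subspace of `X`. -/
def inducedGrading (gr : ℕ → Submodule F R) (X : Submodule F R) (n : ℕ) : Submodule F X :=
  (gr n).comap X.subtype

/-- `X` is a conformal subalgebra which, with the restricted operations and the inherited grading,
is a simple conformal algebra of finite growth. -/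
def IsSimpleSubalgebraOfFiniteGrowth (d : R →ₗ[F] R) (Y : R →ₗ[F] R →ₗ[F] (ℕ →₀ R))
    (gr : ℕ → Submodule F R) (X : Submodule F R) : Prop :=
  ∃ h : IsClosedSubspace d Y X,
    IsConformalAlgebra h.resD h.resY ∧ IsSimple h.resD h.resY ∧
      IsFiniteGrowth h.resD h.resY (inducedGrading gr X)

end General

/-! ### The matrix conformal algebra and its subspaces -/

/-- `M_ι(F) ⊗ F[t₁, t₂]`: finitely supported families of matrices, indexed by the monomials
`t₁^m t₂^n`. -/
def Mat (F ι : Type*) [Field F] : Type _ := (ℕ × ℕ) →₀ Matrix ι ι F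

instance (F ι : Type*) [Field F] : AddCommGroup (Mat F ι) :=
  inferInstanceAs (AddCommGroup ((ℕ × ℕ) →₀ Matrix ι ι F))

instance (F ι : Type*) [Field F] : Module F (Mat F ι) :=
  inferInstanceAs (Module F ((ℕ × ℕ) →₀ Matrix ι ι F))

/-- The coefficients of an element of `M_ι(F) ⊗ F[t₁, t₂]`. -/
def Mat.coeffs (F ι : Type*) [Field F] : Mat F ι ≃ₗ[F] ((ℕ × ℕ) →₀ Matrix ι ι F) :=
  LinearEquiv.refl F ((ℕ × ℕ) →₀ Matrix ι ι F)

/-- `u ↦ u(m, n) = u ⊗ t₁^m t₂^n`, as a linear map. -/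
def elL (F ι : Type*) [Field F] (m n : ℕ) : Matrix ι ι F →ₗ[F] Mat F ι :=
  (Mat.coeffs F ι).symm.toLinearMap ∘ₗ Finsupp.lsingle (m, n)

/-- The element `u(m, n) = u ⊗ t₁^m t₂^n`. -/
def el {F ι : Type*} [Field F] (u : Matrix ι ι F) (m n : ℕ) : Mat F ι := elL F ι m n u

theorem coeffs_el {F ι : Type*} [Field F] (u : Matrix ι ι F) (m n : ℕ) :
    Mat.coeffs F ι (el u m n) = Finsupp.single (m, n) u := rfl

/-- The linear map on `M_ι(F) ⊗ F[t₁, t₂]` that sends `u(m, n)` to `f (m, n) u`. -/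
def extend {F ι P : Type*} [Field F] [AddCommGroup P] [Module F P]
    (f : ℕ × ℕ → Matrix ι ι F →ₗ[F] P) : Mat F ι →ₗ[F] P :=
  Finsupp.lsum F f ∘ₗ (Mat.coeffs F ι).toLinearMap

theorem extend_el {F ι P : Type*} [Field F] [AddCommGroup P] [Module F P]
    (f : ℕ × ℕ → Matrix ι ι F →ₗ[F] P) (u : Matrix ι ι F) (m n : ℕ) :
    extend f (el u m n) = f (m, n) u := by
  simp [extend, coeffs_el]

/-- `∂ (u(m, n)) = (m + 1) u(m + 1, n) + (n + 1) u(m, n + 1)`, extended linearly. -/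
def matD (F ι : Type*) [Field F] : Mat F ι →ₗ[F] Mat F ι :=
  extend fun p =>
    ((p.1 : F) + 1) • elL F ι (p.1 + 1) p.2 + ((p.2 : F) + 1) • elL F ι p.1 (p.2 + 1)

theorem matD_el {F ι : Type*} [Field F] (u : Matrix ι ι F) (m n : ℕ) :
    matD F ι (el u m n) = ((m : F) + 1) • el u (m + 1) n + ((n : F) + 1) • el u m (n + 1) := by
  rw [matD, extend_el]
  rfl

/-- The bilinear map `(u, v) ↦ Y⁺(u(m₁, m₂), z) v(n₁, n₂)`; the summand with
`z^(p-m₁-m₂-n₁-1)` sits at the index `m₁ + m₂ + n₁ - p`, and the one with `z^(q-m₁-m₂-n₂-1)` at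
`m₁ + m₂ + n₂ - q`. The explicit value is in `matY_el`. -/
def matYel (F ι : Type*) [Field F] [Fintype ι] (m₁ m₂ n₁ n₂ : ℕ) :
    Matrix ι ι F →ₗ[F] Matrix ι ι F →ₗ[F] (ℕ →₀ Mat F ι) :=
  ((Ring.choose (-(n₁ : ℤ) - 1) m₂ : ℤ) : F) • ∑ p ∈ range (m₁ + m₂ + n₁ + 1),
      (p.choose m₁ : F) • (LinearMap.mul F (Matrix ι ι F)).compr₂
        (Finsupp.lsingle (m₁ + m₂ + n₁ - p) ∘ₗ elL F ι p n₂)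
    - ((Ring.choose (-(n₂ : ℤ) - 1) m₁ : ℤ) : F) • ∑ q ∈ range (m₁ + m₂ + n₂ + 1),
      (q.choose m₂ : F) • (LinearMap.mul F (Matrix ι ι F)).flip.compr₂
        (Finsupp.lsingle (m₁ + m₂ + n₂ - q) ∘ₗ elL F ι n₁ q)

/-- The structure map `Y⁺`: the bilinear extension of the values `matYel`. -/
def matY (F ι : Type*) [Field F] [Fintype ι] :
    Mat F ι →ₗ[F] Mat F ι →ₗ[F] (ℕ →₀ Mat F ι) :=
  extend fun p => LinearMap.flip (extend fun q => LinearMap.flip (matYel F ι p.1 p.2 q.1 q.2))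

/-- The explicit formula for `Y⁺(u(m₁, m₂), z) v(n₁, n₂)`; `Finsupp.single j x` is
`x z^(-j-1)`. -/
theorem matY_el {F ι : Type*} [Field F] [Fintype ι] (u v : Matrix ι ι F) (m₁ m₂ n₁ n₂ : ℕ) :
    matY F ι (el u m₁ m₂) (el v n₁ n₂) =
      ((Ring.choose (-(n₁ : ℤ) - 1) m₂ : ℤ) : F) • ∑ p ∈ range (m₁ + m₂ + n₁ + 1),
        (p.choose m₁ : F) • Finsupp.single (m₁ + m₂ + n₁ - p) (el (u * v) p n₂)
      - ((Ring.choose (-(n₂ : ℤ) - 1) m₁ : ℤ) : F) • ∑ q ∈ range (m₁ + m₂ + n₂ + 1),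
        (q.choose m₂ : F) • Finsupp.single (m₁ + m₂ + n₂ - q) (el (v * u) n₁ q) := by
  rw [matY, extend_el, LinearMap.flip_apply, extend_el, LinearMap.flip_apply]
  simp only [matYel, LinearMap.sub_apply,
    LinearMap.smul_apply, LinearMap.sum_apply, LinearMap.compr₂_apply, LinearMap.mul_apply',
    LinearMap.comp_apply, Finsupp.lsingle_apply, el]
  rfl

/-- The weight spaces: weight `n` is spanned by the `u(m₁, m₂)` with `m₁ + m₂ + 1 = n`. -/
def matGrading (F ι : Type*) [Field F] (n : ℕ) : Submodule F (Mat F ι) :=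
  Submodule.span F {x | ∃ (u : Matrix ι ι F) (m₁ m₂ : ℕ), m₁ + m₂ + 1 = n ∧ x = el u m₁ m₂}

/-- The subspace `R_ℓ` for `ℓ ≥ 1`: the span of the `u(m, n + ℓ - 1)`. -/
def matSub (F ι : Type*) [Field F] (ℓ : ℕ) : Submodule F (Mat F ι) :=
  Submodule.span F {x | ∃ (u : Matrix ι ι F) (m n : ℕ), x = el u m (n + (ℓ - 1))}

/-- For `ℓ = s + 1 ≥ 1` and a map `σ` on matrices, the span of the elements
`(n + s choose s) u(m, n + s) - (-1)^s (m + s choose s) σ(u)(n, m + s)`. -/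
def matTwist {F ι : Type*} [Field F] (σ : Matrix ι ι F → Matrix ι ι F) (ℓ : ℕ) :
    Submodule F (Mat F ι) :=
  Submodule.span F {x | ∃ (u : Matrix ι ι F) (m n : ℕ),
    x = ((n + (ℓ - 1)).choose (ℓ - 1) : F) • el u m (n + (ℓ - 1))
      - ((-1 : F) ^ (ℓ - 1) * ((m + (ℓ - 1)).choose (ℓ - 1) : F)) • el (σ u) n (m + (ℓ - 1))}

/-- `R*_ℓ`: the twist by the transpose. -/
def matStar (F ι : Type*) [Field F] (ℓ : ℕ) : Submodule F (Mat F ι) :=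
  matTwist (fun u => u.transpose) ℓ

/-- The symplectic anti-automorphism of the matrices of even size. -/
def dagger {F κ : Type*} [Field F] [Fintype κ] [DecidableEq κ]
    (u : Matrix (κ ⊕ κ) (κ ⊕ κ) F) : Matrix (κ ⊕ κ) (κ ⊕ κ) F :=
  Matrix.fromBlocks 0 (-1) 1 0 * u.transpose * Matrix.fromBlocks 0 1 (-1) 0

/-- `R†_ℓ`: the twist by the symplectic anti-automorphism. -/
def matDagger (F κ : Type*) [Field F] [Fintype κ] [DecidableEq κ] (ℓ : ℕ) :
    Submodule F (Mat F (κ ⊕ κ)) :=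
  matTwist dagger ℓ

end Conformal

end

noncomputable section

namespace Conformal

/-! ### Recovering the coefficients of vector-valued polynomials from their values -/

section Extraction

/-! Read `el u m n` as the matrix polynomial u X^m Y^n / (m! n!). Then ∂ is multiplication by X + Y,
and the generating function ∑ t^j/j! · u_j v of the coefficients of Y⁺ becomes, for polynomials f
and g, f(x, -x-t) g(x+t, y) - g(x, y+t) f(-y-t, y), which is `ev_expSum_matY`. A field of
characteristic 0 is infinite, so values at all points determine a polynomial. The axioms thus turn
into substitutions in this formula: skew-symmetry exchanges t with -t-x-y, and Jacobi reduces to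
associativity of the matrix product.

All the subspaces are instances of `twistSpan s ε σ`, the span of the Y^s (f(X, Y) + ε σ(f)(Y, X))
for an anti-involution σ, with ε = 0 for R_ℓ and ε = -(-1)^s for the twisted families. Exchanging X
and Y and applying σ swaps the two products in the bracket up to the sign (-1)^s; this is why
exactly that ε gives a closed subspace (`leftTerm_twist_mem`).

Freeness over F[∂] comes from the coordinates X + Y and X - Y: a basis space V is spanned by the Y^s
(X-Y)^d (u + ε (-1)^d σ(u)), so each weight contributes at most dim M_k.

For simplicity, bracket an element g of an ideal with powers of X and take coefficients of large
index j. Only one of the two products survives, and finite differences of the binomials in it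
separate the coefficients g_n(X) of Y^n in g. The ideal then contains the twists of g_n(X) Y^e a for
every e and a (`column_mem`). A second round isolates a single nonzero matrix coefficient c, and the
simplicity of the matrix algebra yields every generator. -/

theorem exists_bound {V : Type*} [AddCommGroup V] (c : ℕ →₀ V) : ∃ N, ∀ j, N ≤ j → c j = 0 := by
  refine ⟨c.support.sup id + 1, fun j hj => ?_⟩
  by_contra hc
  have := Finset.le_sup (f := id) (Finsupp.mem_support_iff.2 hc)
  simp only [id] at this
  omega

variable {F V : Type*} [Field F] [CharZero F] [AddCommGroup V] [Module F V]

/-- If a vector-valued polynomial takes all but finitely many of its values in a subspace, then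
its coefficients lie in that subspace. -/
theorem mem_of_sum_pow_smul_mem (I : Submodule F V) (N : ℕ) :
    ∀ (c : ℕ → V) (T : Finset F), (∀ x ∉ T, ∑ j ∈ range N, x ^ j • c j ∈ I) →
      ∀ j < N, c j ∈ I := by
  classical
  induction N with
  | zero => intro c T _ j hj; omega
  | succ N ih =>
    intro c T h
    have key : ∀ j < N, c j ∈ I := by
      intro j hj
      -- The combination p(2x) - 2^N p(x) kills the coefficient of degree N and scales that of
      -- degree j < N by 2^j - 2^N, which is nonzero in characteristic 0. Both x and 2x must avoid
      -- `T`.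
      have h1 := ih (fun j => ((2 : F) ^ j - 2 ^ N) • c j) (T ∪ T.image fun x => x / 2) ?_ j hj
      · have hne : (2 : F) ^ j - 2 ^ N ≠ 0 := by
          rw [sub_ne_zero]
          exact_mod_cast (Nat.pow_lt_pow_right (by norm_num : 1 < 2) hj).ne
        exact (I.smul_mem_iff hne).1 h1
      · intro x hx
        simp only [mem_union, mem_image, not_or, not_exists, not_and] at hx
        have h2x : 2 * x ∉ T := fun hm => hx.2 _ hm (by field_simp)
        have := I.sub_mem (h _ h2x) (I.smul_mem ((2 : F) ^ N) (h _ hx.1))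
        convert this using 1
        rw [smul_sum, ← sum_sub_distrib, sum_range_succ]
        simp only [smul_smul, ← sub_smul]
        have h0 : ((2 * x) ^ N - 2 ^ N * x ^ N) = 0 := by ring
        rw [h0, zero_smul, add_zero]
        refine sum_congr rfl fun i _ => ?_
        congr 1
        ring
    intro j hj
    rcases Nat.lt_succ_iff_lt_or_eq.1 hj with hj | rfl
    · exact key j hj
    · obtain ⟨x, hx⟩ := Infinite.exists_notMem_finset (insert 0 T)
      simp only [mem_insert, not_or] at hx
      have h1 := h x hx.2
      rw [sum_range_succ] at h1
      have h2 := (Submodule.add_mem_iff_right I (I.sum_mem fun i hi =>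
        I.smul_mem (x ^ i) (key i (mem_range.1 hi)))).1 h1
      exact (I.smul_mem_iff (pow_ne_zero _ hx.1)).1 h2

theorem eq_zero_of_sum_pow_smul_eq_zero (N : ℕ) (c : ℕ → V) (T : Finset F)
    (h : ∀ x ∉ T, ∑ j ∈ range N, x ^ j • c j = 0) (j : ℕ) (hj : j < N) : c j = 0 := by
  have := mem_of_sum_pow_smul_mem (⊥ : Submodule F V) N c T (by simpa using h) j hj
  simpa using this

/-- The value `∑ j, x^j / j! • c j` of a finite family at `x`. -/
def expSum (x : F) : (ℕ →₀ V) →ₗ[F] V :=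
  Finsupp.lsum F fun j => (x ^ j * ((j ! : ℕ) : F)⁻¹) • LinearMap.id

omit [CharZero F] in
theorem expSum_single (x : F) (j : ℕ) (v : V) :
    expSum x (Finsupp.single j v) = (x ^ j * ((j ! : ℕ) : F)⁻¹) • v := by
  simp [expSum]

omit [CharZero F] in
theorem expSum_eq_sum_range (x : F) (c : ℕ →₀ V) (N : ℕ) (hN : ∀ j, N ≤ j → c j = 0) :
    expSum x c = ∑ j ∈ range N, (x ^ j * ((j ! : ℕ) : F)⁻¹) • c j := by
  rw [expSum, Finsupp.lsum_apply, Finsupp.sum_of_support_subset _ (s := range N)]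
  · rfl
  · intro j hj
    rw [mem_range]
    by_contra hc
    exact (Finsupp.mem_support_iff.1 hj) (hN j (by omega))
  · intro i _
    simp

omit [CharZero F] in
-- Only finitely many `c n` are nonzero, so their individual bounds have a common maximum. The
-- Jacobi identity needs this uniformity to be compared in one finite box of coefficients.
theorem exists_bound_comp {W : Type*} [AddCommGroup W] [Module F W]
    (L : V →ₗ[F] (ℕ →₀ W)) (c : ℕ →₀ V) : ∃ N, ∀ n j, N ≤ j → L (c n) j = 0 := by
  choose B hB using fun n => exists_bound (L (c n))
  obtain ⟨M, hM⟩ := exists_bound c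
  refine ⟨(range M).sup B, fun n j hj => ?_⟩
  by_cases hn : n < M
  · exact hB n j ((Finset.le_sup (mem_range.2 hn)).trans hj)
  · rw [hM n (by omega), map_zero]
    rfl

theorem eq_zero_of_expSum_eq_zero (c : ℕ →₀ V) (h : ∀ x : F, expSum x c = 0) : c = 0 := by
  obtain ⟨N, hN⟩ := exists_bound c
  ext j
  by_cases hj : j < N
  · have := eq_zero_of_sum_pow_smul_eq_zero (F := F) N (fun j => ((j ! : ℕ) : F)⁻¹ • c j) ∅
      (fun x _ => by
        rw [← h x, expSum_eq_sum_range x c N hN]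
        simp only [smul_smul]) j hj
    rcases smul_eq_zero.1 this with h0 | h0
    · exact absurd h0 (inv_ne_zero (by exact_mod_cast j.factorial_ne_zero))
    · exact h0
  · exact hN j (by omega)

theorem expSum_injective {c c' : ℕ →₀ V} (h : ∀ x : F, expSum x c = expSum x c') : c = c' := by
  rw [← sub_eq_zero]
  exact eq_zero_of_expSum_eq_zero (F := F) _ fun x => by rw [map_sub, h x, sub_self]

theorem eq_zero_of_double_sum (N : ℕ) (c : ℕ → ℕ → V)
    (h : ∀ x y : F, ∑ m ∈ range N, ∑ n ∈ range N,
      ((x ^ m * ((m ! : ℕ) : F)⁻¹) * (y ^ n * ((n ! : ℕ) : F)⁻¹)) • c m n = 0)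
    (m n : ℕ) (hm : m < N) (hn : n < N) : c m n = 0 := by
  have h1 : ∀ y : F, ∑ n ∈ range N, y ^ n • (((m ! : ℕ) : F)⁻¹ * ((n ! : ℕ) : F)⁻¹) • c m n = 0 := by
    intro y
    refine eq_zero_of_sum_pow_smul_eq_zero (F := F) N (fun m => ∑ n ∈ range N,
      y ^ n • (((m ! : ℕ) : F)⁻¹ * ((n ! : ℕ) : F)⁻¹) • c m n) ∅ (fun x _ => ?_) m hm
    rw [← h x y]
    refine sum_congr rfl fun i _ => ?_
    rw [smul_sum]
    refine sum_congr rfl fun k _ => ?_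
    rw [smul_smul, smul_smul]
    congr 1
    ring
  have h2 := eq_zero_of_sum_pow_smul_eq_zero (F := F) N _ ∅ (fun y _ => h1 y) n hn
  refine (smul_eq_zero.1 h2).resolve_left (mul_ne_zero ?_ ?_) <;>
    exact inv_ne_zero (by exact_mod_cast Nat.factorial_ne_zero _)

end Extraction

theorem sum_box_eq_sum_diag {M : Type*} [AddCommMonoid M] (K : ℕ) (f : ℕ → ℕ → M)
    (hf : ∀ a c, K ≤ a + c → f a c = 0) :
    ∑ a ∈ range K, ∑ c ∈ range K, f a c = ∑ k ∈ range K, ∑ a ∈ range (k + 1), f a (k - a) := by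
  rw [Finset.sum_sigma', Finset.sum_sigma']
  symm
  refine Finset.sum_bij_ne_zero (fun p _ _ => ⟨p.2, p.1 - p.2⟩) ?_ ?_ ?_ ?_
  · rintro ⟨k, a⟩ h _
    simp only [mem_sigma, mem_range] at h ⊢
    omega
  · rintro ⟨k, a⟩ h _ ⟨k', a'⟩ h' _ he
    simp only [mem_sigma, mem_range, Sigma.mk.injEq, heq_eq_eq] at h h' he ⊢
    omega
  · rintro ⟨a, c⟩ h hne
    simp only [mem_sigma, mem_range] at h
    have hlt : a + c < K := by
      by_contra hc
      exact hne (hf a c (by omega))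
    refine ⟨⟨a + c, a⟩, by simp only [mem_sigma, mem_range]; omega, ?_, ?_⟩
    · simpa using hne
    · simp
  · intro p _ _
    rfl

/-! ### The polynomial model and its bracket -/

section Mat

variable {F ι : Type*} [Field F]

theorem Mat.induction {p : Mat F ι → Prop} (f : Mat F ι) (h0 : p 0)
    (hadd : ∀ f g, p f → p g → p (f + g)) (hel : ∀ u m n, p (el u m n)) : p f :=
  Finsupp.induction_linear (motive := p) f h0 hadd fun a u => hel u a.1 a.2

theorem el_eq (u : Matrix ι ι F) (m n : ℕ) : el u m n = elL F ι m n u := rfl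

/-- `u(m, n)` corresponds to the polynomial `u X^m Y^n / (m! n!)`; this is its value at `(x, y)`. -/
def ev (x y : F) : Mat F ι →ₗ[F] Matrix ι ι F :=
  extend fun p => ((x ^ p.1 * ((p.1 ! : ℕ) : F)⁻¹) * (y ^ p.2 * ((p.2 ! : ℕ) : F)⁻¹)) •
    LinearMap.id

theorem ev_el (x y : F) (u : Matrix ι ι F) (m n : ℕ) : ev x y (el u m n) =
    ((x ^ m * ((m ! : ℕ) : F)⁻¹) * (y ^ n * ((n ! : ℕ) : F)⁻¹)) • u := by
  rw [ev, extend_el]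
  rfl

theorem exists_eq_sum_el (f : Mat F ι) : ∃ (N : ℕ) (G : ℕ → ℕ → Matrix ι ι F),
    (∀ m n, N ≤ m ∨ N ≤ n → G m n = 0) ∧
    f = ∑ m ∈ range N, ∑ n ∈ range N, el (G m n) m n := by
  refine ⟨((Mat.coeffs F ι f).support.sup fun p => p.1 + p.2) + 1,
    fun m n => Mat.coeffs F ι f (m, n), ?_, ?_⟩
  · intro m n h
    by_contra hc
    have := Finset.le_sup (f := fun p : ℕ × ℕ => p.1 + p.2) (Finsupp.mem_support_iff.2 hc)
    simp only at this
    omega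
  · apply (Mat.coeffs F ι).injective
    simp only [map_sum, coeffs_el]
    rw [← Finset.sum_product' (range _) (range _)
      (fun m n => Finsupp.single (m, n) ((Mat.coeffs F ι) f (m, n)))]
    conv_lhs => rw [← Finsupp.sum_single (Mat.coeffs F ι f)]
    rw [Finsupp.sum_of_support_subset]
    · intro p hp
      have := Finset.le_sup (f := fun p : ℕ × ℕ => p.1 + p.2) hp
      simp only [mem_product, mem_range] at this ⊢
      omega
    · intro i _
      simp

theorem eq_zero_of_ev_eq_zero [CharZero F] (f : Mat F ι) (h : ∀ x y, ev x y f = 0) : f = 0 := by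
  obtain ⟨N, G, -, rfl⟩ := exists_eq_sum_el f
  refine Finset.sum_eq_zero fun m hm => Finset.sum_eq_zero fun n hn => ?_
  rw [eq_zero_of_double_sum (F := F) N G (fun x y => ?_) m n (mem_range.1 hm) (mem_range.1 hn), el_eq,
    map_zero]
  rw [← h x y]
  simp only [map_sum, ev_el]

theorem ev_injective [CharZero F] {f g : Mat F ι} (h : ∀ x y, ev x y f = ev x y g) : f = g := by
  rw [← sub_eq_zero]
  exact eq_zero_of_ev_eq_zero _ fun x y => by rw [map_sub, h, sub_self]

theorem inv_factorial_succ [CharZero F] (m : ℕ) :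
    ((m : F) + 1) * (((m + 1)! : ℕ) : F)⁻¹ = ((m ! : ℕ) : F)⁻¹ := by
  have h1 : (m : F) + 1 ≠ 0 := by exact_mod_cast m.succ_ne_zero
  have h2 : ((m ! : ℕ) : F) ≠ 0 := by exact_mod_cast m.factorial_ne_zero
  rw [Nat.factorial_succ]
  push_cast
  field_simp

/-- The divided powers absorb the factors m + 1 and n + 1 of ∂, since (m+1)/(m+1)! = 1/m!. -/
theorem ev_matD [CharZero F] (x y : F) (f : Mat F ι) : ev x y (matD F ι f) = (x + y) • ev x y f := by
  induction f using Mat.induction with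
  | h0 => simp
  | hadd f g hf hg => simp only [map_add, smul_add, hf, hg]
  | hel u m n =>
    simp only [matD_el, map_add, map_smul, ev_el, smul_smul, ← add_smul]
    congr 1
    rw [← inv_factorial_succ m, ← inv_factorial_succ n]
    ring

theorem choose_neg_sub_one (n k : ℕ) :
    ((Ring.choose (-(n : ℤ) - 1) k : ℤ) : F) = (-1) ^ k * ((n + k).choose k : F) := by
  have h : (-(n : ℤ) - 1) = -((n + 1 : ℕ) : ℤ) := by push_cast; ring
  rw [h, Ring.choose_neg]
  rw [show (((n + 1 : ℕ) : ℤ) + k - 1) = ((n + k : ℕ) : ℤ) by push_cast; ring, Ring.choose_natCast]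
  rw [Int.negOnePow_def]
  simp [Units.smul_def]

/-- The convolution `∑ p, (p choose a) λ^(a+M-p)/(a+M-p)! x^p/p! = x^a/a! (x+λ)^M/M!`. -/
theorem sum_choose_mul_pow [CharZero F] (a M : ℕ) (x t : F) :
    ∑ p ∈ range (a + M + 1), (p.choose a : F) *
      ((t ^ (a + M - p) * (((a + M - p)! : ℕ) : F)⁻¹) * (x ^ p * ((p ! : ℕ) : F)⁻¹)) =
    (x ^ a * ((a ! : ℕ) : F)⁻¹) * ((x + t) ^ M * ((M ! : ℕ) : F)⁻¹) := by
  rw [show a + M + 1 = a + (M + 1) by ring, sum_range_add, Finset.sum_eq_zero, zero_add, add_pow,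
    sum_mul, mul_sum]
  · refine sum_congr rfl fun r hr => ?_
    have hr : r ≤ M := by simpa [Nat.lt_succ_iff] using hr
    rw [show a + M - (a + r) = M - r by omega, Nat.cast_choose F (Nat.le_add_right a r),
      Nat.cast_choose F hr, Nat.add_sub_cancel_left, pow_add]
    have h1 : (((a + r)! : ℕ) : F) ≠ 0 := by exact_mod_cast Nat.factorial_ne_zero _
    have h2 : ((M ! : ℕ) : F) ≠ 0 := by exact_mod_cast Nat.factorial_ne_zero _
    field_simp
  · intro p hp
    rw [Nat.choose_eq_zero_of_lt (mem_range.1 hp)]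
    simp

variable [Fintype ι] [CharZero F]

/-- In the first product the sum over p is a convolution with value x^m₁/m₁! ·
(x+t)^(m₂+n₁)/(m₂+n₁)!. The binomial prefactor splits the last factorial into m₂! n₁!, and its sign
turns (x+t)^m₂ into (-x-t)^m₂. The second product is symmetric. -/
theorem ev_expSum_matY_el (x y t : F) (u v : Matrix ι ι F) (m₁ m₂ n₁ n₂ : ℕ) :
    ev x y (expSum t (matY F ι (el u m₁ m₂) (el v n₁ n₂))) =
      ev x (-x - t) (el u m₁ m₂) * ev (x + t) y (el v n₁ n₂) -
        ev x (y + t) (el v n₁ n₂) * ev (-y - t) y (el u m₁ m₂) := by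
  have hch : ∀ a b : ℕ, ((a + b).choose b : F) * (((b + a)! : ℕ) : F)⁻¹ =
      ((b ! : ℕ) : F)⁻¹ * ((a ! : ℕ) : F)⁻¹ := by
    intro a b
    rw [Nat.cast_choose F (Nat.le_add_left b a), Nat.add_sub_cancel, add_comm b a]
    have h1 : (((a + b)! : ℕ) : F) ≠ 0 := by exact_mod_cast Nat.factorial_ne_zero _
    field_simp
  rw [matY_el, choose_neg_sub_one, choose_neg_sub_one]
  simp only [map_sub, map_smul, map_sum, expSum_single, ev_el, smul_smul, ← sum_smul, smul_mul_smul_comm,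
    smul_sum]
  congr 2
  · have := sum_choose_mul_pow m₁ (m₂ + n₁) x t
    rw [show m₁ + m₂ + n₁ = m₁ + (m₂ + n₁) by ring]
    calc _ = ((-1) ^ m₂ * ((n₁ + m₂).choose m₂ : F)) * (∑ p ∈ range (m₁ + (m₂ + n₁) + 1),
          (p.choose m₁ : F) * ((t ^ (m₁ + (m₂ + n₁) - p) *
            (((m₁ + (m₂ + n₁) - p)! : ℕ) : F)⁻¹) * (x ^ p * ((p ! : ℕ) : F)⁻¹))) *
          (y ^ n₂ * ((n₂ ! : ℕ) : F)⁻¹) := by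
          rw [mul_sum, sum_mul]
          exact sum_congr rfl fun i _ => by ring
      _ = _ := by
          rw [this, show (-x - t) = (-1) * (x + t) by ring, mul_pow, pow_add]
          linear_combination ((-1) ^ m₂ * (x ^ m₁ * ((m₁ ! : ℕ) : F)⁻¹) *
            ((x + t) ^ m₂ * (x + t) ^ n₁) * (y ^ n₂ * ((n₂ ! : ℕ) : F)⁻¹)) * hch n₁ m₂
  · have := sum_choose_mul_pow m₂ (m₁ + n₂) y t
    rw [show m₁ + m₂ + n₂ = m₂ + (m₁ + n₂) by ring]
    calc _ = ((-1) ^ m₁ * ((n₂ + m₁).choose m₁ : F)) * (∑ p ∈ range (m₂ + (m₁ + n₂) + 1),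
          (p.choose m₂ : F) * ((t ^ (m₂ + (m₁ + n₂) - p) *
            (((m₂ + (m₁ + n₂) - p)! : ℕ) : F)⁻¹) * (y ^ p * ((p ! : ℕ) : F)⁻¹))) *
          (x ^ n₁ * ((n₁ ! : ℕ) : F)⁻¹) := by
          rw [mul_sum, sum_mul]
          exact sum_congr rfl fun i _ => by ring
      _ = _ := by
          rw [this, show (-y - t) = (-1) * (y + t) by ring, mul_pow, pow_add]
          linear_combination ((-1) ^ m₁ * (y ^ m₂ * ((m₂ ! : ℕ) : F)⁻¹) *
            ((y + t) ^ m₁ * (y + t) ^ n₂) * (x ^ n₁ * ((n₁ ! : ℕ) : F)⁻¹)) * hch n₂ m₁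

/-- The `λ`-bracket of the matrix conformal algebra as a polynomial identity. -/
theorem ev_expSum_matY (x y t : F) (u v : Mat F ι) :
    ev x y (expSum t (matY F ι u v)) =
      ev x (-x - t) u * ev (x + t) y v - ev x (y + t) v * ev (-y - t) y u := by
  induction u using Mat.induction with
  | h0 => simp
  | hadd f g hf hg =>
    simp only [map_add, LinearMap.add_apply, hf, hg, add_mul, mul_add]
    abel
  | hel u m n =>
    induction v using Mat.induction with
    | h0 => simp
    | hadd f g hf hg =>
      simp only [map_add, hf, hg, add_mul, mul_add]
      abel
    | hel v m' n' => exact ev_expSum_matY_el x y t u v m n m' n'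

end Mat

/-! ### The conformal algebra axioms for the matrix algebra -/

section Axioms

variable {F ι : Type*} [Field F] [CharZero F] [Fintype ι]

omit [Fintype ι] in
theorem ev_matD_pow (x y : F) (n : ℕ) (f : Mat F ι) :
    ev x y ((matD F ι ^ n) f) = (x + y) ^ n • ev x y f := by
  induction n with
  | zero => simp
  | succ n ih => rw [pow_succ', Module.End.mul_apply, ev_matD, ih, smul_smul, pow_succ']

theorem expSum_matY_matD (t : F) (u v : Mat F ι) :
    expSum t (matY F ι (matD F ι u) v) = -t • expSum t (matY F ι u v) := by
  refine ev_injective fun x y => ?_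
  rw [map_smul, ev_expSum_matY, ev_expSum_matY, ev_matD, ev_matD, smul_mul_assoc, mul_smul_comm,
    smul_sub]
  congr 2 <;> ring

theorem matY_matD (u v : Mat F ι) :
    matY F ι (matD F ι u) v = (matY F ι u v).sum fun j w =>
      Finsupp.single (j + 1) (-((j : F) + 1) • w) := by
  refine expSum_injective (F := F) fun t => ?_
  rw [expSum_matY_matD, map_finsuppSum]
  conv_lhs => rw [expSum, Finsupp.lsum_apply, Finsupp.smul_sum]
  refine Finsupp.sum_congr fun j _ => ?_
  rw [expSum_single, LinearMap.smul_apply, LinearMap.id_apply, smul_smul, smul_smul,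
    ← inv_factorial_succ j]
  congr 1
  ring

theorem matY_skew_expSum (t : F) (u v : Mat F ι) :
    expSum t (matY F ι u v) = expSum t ((matY F ι v u).sum fun m w =>
      ∑ j ∈ range (m + 1), Finsupp.single j
        (((-1 : F) ^ (m + 1) * (((m - j)! : ℕ) : F)⁻¹) • (matD F ι ^ (m - j)) w)) := by
  refine ev_injective fun x y => ?_
  -- Skew-symmetry in closed form: t is replaced by -t-x-y, that is, by -t-∂. Expanding (-t-(x+y))^m
  -- by the binomial theorem then gives the terms ∂^(m-j)/(m-j)!.
  have h : ev x y (expSum t (matY F ι u v)) = -ev x y (expSum (-t - x - y) (matY F ι v u)) := by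
    rw [ev_expSum_matY, ev_expSum_matY, neg_sub]
    congr 3 <;> congr 1 <;> ring
  rw [h, map_finsuppSum, map_finsuppSum, expSum, Finsupp.lsum_apply, map_finsuppSum,
    ← Finsupp.sum_neg]
  refine Finsupp.sum_congr fun m _ => ?_
  simp only [map_sum, expSum_single, map_smul, ev_matD_pow, smul_smul, ← sum_smul,
    LinearMap.smul_apply, LinearMap.id_apply, ← neg_smul]
  congr 1
  rw [show -t - x - y = (-1) * (t + (x + y)) by ring, mul_pow, add_pow, mul_sum, sum_mul,
    ← sum_neg_distrib]
  refine sum_congr rfl fun j hj => ?_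
  have hj : j ≤ m := by simpa [Nat.lt_succ_iff] using hj
  rw [Nat.cast_choose F hj]
  have h1 : ((m ! : ℕ) : F) ≠ 0 := by exact_mod_cast Nat.factorial_ne_zero _
  field_simp
  ring

theorem matY_skew (u v : Mat F ι) (j : ℕ) : matY F ι u v j = (matY F ι v u).sum fun m w =>
    if j ≤ m then ((-1 : F) ^ (m + 1) * (((m - j)! : ℕ) : F)⁻¹) • (matD F ι ^ (m - j)) w else 0 := by
  rw [expSum_injective (F := F) fun t => matY_skew_expSum t u v, Finsupp.sum_apply]
  refine Finsupp.sum_congr fun m _ => ?_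
  rw [Finsupp.finsetSum_apply]
  simp only [Finsupp.single_apply, sum_ite_eq', mem_range, Nat.lt_succ_iff]

theorem matY_expSum_jacobi (s t : F) (u v w : Mat F ι) :
    expSum s (matY F ι u (expSum t (matY F ι v w))) - expSum t (matY F ι v (expSum s (matY F ι u w)))
      = expSum (s + t) (matY F ι (expSum s (matY F ι u v)) w) := by
  refine ev_injective fun x y => ?_
  simp only [map_sub, ev_expSum_matY]
  -- Once the arguments of `ev` are in a common form, the triple products cancel by associativity
  -- alone.
  have e1 : -(x + s) - t = -x - (s + t) := by ring
  have e2 : -(x + t) - s = -x - (s + t) := by ring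
  have e3 : -x - (s + t) + s = -x - t := by ring
  have e4 : -(-x - (s + t)) - s = x + t := by ring
  have e5 : -y - (s + t) + s = -y - t := by ring
  have e7 : -(y + t) - s = -y - (s + t) := by ring
  have e8 : -(y + s) - t = -y - (s + t) := by ring
  have e9 : x + s + t = x + (s + t) := by ring
  have e10 : x + t + s = x + (s + t) := by ring
  have e11 : y + s + t = y + (s + t) := by ring
  have e12 : y + t + s = y + (s + t) := by ring
  have e13 : -(-y - (s + t)) - s = y + t := by ring
  simp only [e1, e2, e3, e4, e5, e7, e8, e9, e10, e11, e12, e13]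
  noncomm_ring

omit [Fintype ι] in
-- Expand (s+t)^k/k! and collect s^m t^n: the factor 1/(i! (m-i)!) is (m choose i)/m!. Since i and k
-- stay below `N`, every exponent fits in the box of side `N + N`.
theorem expSum_double_coeff (N : ℕ) (b : ℕ → ℕ → Mat F ι)
    (hb : ∀ i k, N ≤ i ∨ N ≤ k → b i k = 0) (s t : F) :
    ∑ i ∈ range N, ∑ k ∈ range N, ((s ^ i * ((i ! : ℕ) : F)⁻¹) *
        ((s + t) ^ k * ((k ! : ℕ) : F)⁻¹)) • b i k =
      ∑ m ∈ range (N + N), ∑ n ∈ range (N + N),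
        ((s ^ m * ((m ! : ℕ) : F)⁻¹) * (t ^ n * ((n ! : ℕ) : F)⁻¹)) •
          ∑ i ∈ range (m + 1), (m.choose i : F) • b i (m + n - i) := by
  have hsub : range N ⊆ range (N + N) := range_subset_range.2 (by omega)
  have hf : ∀ k : ℕ, ((k ! : ℕ) : F) ≠ 0 := fun k => by exact_mod_cast Nat.factorial_ne_zero _
  calc _ = ∑ i ∈ range (N + N), ∑ k ∈ range (N + N), ((s ^ i * ((i ! : ℕ) : F)⁻¹) *
        ((s + t) ^ k * ((k ! : ℕ) : F)⁻¹)) • b i k := by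
        rw [← sum_subset hsub fun i _ hi => sum_eq_zero fun k _ => by
          rw [hb i k (Or.inl (by simpa using hi)), smul_zero]]
        refine sum_congr rfl fun i _ => sum_subset hsub fun k _ hk => ?_
        rw [hb i k (Or.inr (by simpa using hk)), smul_zero]
    _ = ∑ i ∈ range (N + N), ∑ k ∈ range (N + N), ∑ a ∈ range (k + 1),
          ((s ^ i * ((i ! : ℕ) : F)⁻¹) * ((s ^ a * ((a ! : ℕ) : F)⁻¹) *
            (t ^ (k - a) * (((k - a)! : ℕ) : F)⁻¹))) • b i (a + (k - a)) := by
        refine sum_congr rfl fun i _ => sum_congr rfl fun k _ => ?_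
        rw [add_pow, sum_mul, mul_sum, sum_smul]
        refine sum_congr rfl fun a ha => ?_
        have ha : a ≤ k := by simpa [Nat.lt_succ_iff] using ha
        rw [Nat.add_sub_cancel' ha, Nat.cast_choose F ha]
        congr 1
        have := hf k
        field_simp
    _ = ∑ i ∈ range (N + N), ∑ a ∈ range (N + N), ∑ c ∈ range (N + N),
          ((s ^ i * ((i ! : ℕ) : F)⁻¹) * ((s ^ a * ((a ! : ℕ) : F)⁻¹) *
            (t ^ c * ((c ! : ℕ) : F)⁻¹))) • b i (a + c) := by
        refine sum_congr rfl fun i _ => ?_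
        rw [sum_box_eq_sum_diag (N + N) (fun a c => ((s ^ i * ((i ! : ℕ) : F)⁻¹) *
          ((s ^ a * ((a ! : ℕ) : F)⁻¹) * (t ^ c * ((c ! : ℕ) : F)⁻¹))) • b i (a + c))]
        intro a c hac
        rw [hb i _ (Or.inr (by omega)), smul_zero]
    _ = ∑ m ∈ range (N + N), ∑ i ∈ range (m + 1), ∑ c ∈ range (N + N),
          ((s ^ i * ((i ! : ℕ) : F)⁻¹) * ((s ^ (m - i) * (((m - i)! : ℕ) : F)⁻¹) *
            (t ^ c * ((c ! : ℕ) : F)⁻¹))) • b i (m - i + c) := by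
        rw [sum_box_eq_sum_diag (N + N) (fun i a => ∑ c ∈ range (N + N),
          ((s ^ i * ((i ! : ℕ) : F)⁻¹) * ((s ^ a * ((a ! : ℕ) : F)⁻¹) *
            (t ^ c * ((c ! : ℕ) : F)⁻¹))) • b i (a + c))]
        intro i a hia
        refine sum_eq_zero fun c _ => ?_
        rw [hb i _ (by omega), smul_zero]
    _ = _ := by
        refine sum_congr rfl fun m _ => ?_
        rw [sum_comm]
        refine sum_congr rfl fun c _ => ?_
        rw [smul_sum]
        refine sum_congr rfl fun i hi => ?_
        have hi : i ≤ m := by simpa [Nat.lt_succ_iff] using hi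
        rw [show m - i + c = m + c - i by omega, smul_smul, Nat.cast_choose F hi]
        congr 1
        have := hf m
        rw [show s ^ m = s ^ i * s ^ (m - i) by rw [← pow_add, Nat.add_sub_cancel' hi]]
        field_simp

omit [CharZero F] in
theorem expSum_expSum (N : ℕ) (u : Mat F ι) (g : ℕ →₀ Mat F ι) (s t : F)
    (h1 : ∀ n, N ≤ n → g n = 0) (h2 : ∀ n j, N ≤ j → matY F ι u (g n) j = 0) :
    expSum s (matY F ι u (expSum t g)) = ∑ m ∈ range N, ∑ n ∈ range N,
      ((s ^ m * ((m ! : ℕ) : F)⁻¹) * (t ^ n * ((n ! : ℕ) : F)⁻¹)) • matY F ι u (g n) m := by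
  rw [expSum_eq_sum_range t g N h1, map_sum, map_sum, sum_comm]
  refine sum_congr rfl fun n _ => ?_
  rw [map_smul, map_smul, expSum_eq_sum_range s _ N (h2 n), smul_sum]
  refine sum_congr rfl fun m _ => ?_
  rw [smul_smul, mul_comm]

theorem matY_jacobi (u v w : Mat F ι) (m n : ℕ) :
    matY F ι u (matY F ι v w n) m - matY F ι v (matY F ι u w m) n =
      ∑ i ∈ range (m + 1), (m.choose i : F) • matY F ι (matY F ι u v i) w (m + n - i) := by
  obtain ⟨N1, h1⟩ := exists_bound (matY F ι v w)
  obtain ⟨N2, h2⟩ := exists_bound (matY F ι u w)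
  obtain ⟨N3, h3⟩ := exists_bound (matY F ι u v)
  obtain ⟨N4, h4⟩ := exists_bound_comp (matY F ι u) (matY F ι v w)
  obtain ⟨N5, h5⟩ := exists_bound_comp (matY F ι v) (matY F ι u w)
  obtain ⟨N6, h6⟩ := exists_bound_comp ((matY F ι).flip w) (matY F ι u v)
  set N := N1 + N2 + N3 + N4 + N5 + N6 + m + n + 1 with hN
  have hb : ∀ i k, N ≤ i ∨ N ≤ k → matY F ι (matY F ι u v i) w k = 0 := by
    rintro i k (h | h)
    · rw [h3 i (by omega), map_zero]
      rfl
    · exact h6 i k (by omega)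
  have key := eq_zero_of_double_sum (F := F) (N + N) (fun m n =>
    matY F ι u (matY F ι v w n) m - matY F ι v (matY F ι u w m) n -
      ∑ i ∈ range (m + 1), (m.choose i : F) • matY F ι (matY F ι u v i) w (m + n - i)) ?_ m n
      (by omega) (by omega)
  · exact sub_eq_zero.1 key
  intro s t
  have hj := matY_expSum_jacobi s t u v w
  rw [expSum_expSum (N + N) u _ s t (fun n hn => h1 n (by omega)) (fun n j hn => h4 n j (by omega)),
    expSum_expSum (N + N) v _ t s (fun n hn => h2 n (by omega)) (fun n j hn => h5 n j (by omega))] at hj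
  have hr : expSum (s + t) (matY F ι (expSum s (matY F ι u v)) w) =
      ∑ i ∈ range N, ∑ k ∈ range N, ((s ^ i * ((i ! : ℕ) : F)⁻¹) *
        ((s + t) ^ k * ((k ! : ℕ) : F)⁻¹)) • matY F ι (matY F ι u v i) w k := by
    rw [expSum_eq_sum_range s _ N (fun n hn => h3 n (by omega)), map_sum, LinearMap.sum_apply,
      map_sum]
    refine sum_congr rfl fun i _ => ?_
    rw [map_smul, LinearMap.smul_apply, map_smul,
      expSum_eq_sum_range (s + t) _ N (fun k hk => hb i k (Or.inr hk)), smul_sum]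
    refine sum_congr rfl fun k _ => ?_
    rw [smul_smul]
  rw [hr, expSum_double_coeff N _ hb] at hj
  simp only [smul_sub, sum_sub_distrib]
  rw [sub_eq_zero, ← hj]
  congr 1
  rw [sum_comm]
  refine sum_congr rfl fun a _ => sum_congr rfl fun b _ => ?_
  rw [mul_comm]

theorem isConformalAlgebra_mat : IsConformalAlgebra (matD F ι) (matY F ι) where
  deriv_zero u v := by
    rw [matY_matD, Finsupp.sum_apply]
    simp [Finsupp.sum]
  deriv_succ u v j := by
    rw [matY_matD, Finsupp.sum_apply]
    simp only [Finsupp.single_apply, add_left_inj]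
    rw [Finsupp.sum, sum_ite_eq']
    split_ifs with h
    · rfl
    · rw [Finsupp.notMem_support_iff.1 h, smul_zero]
  skew := matY_skew
  jacobi := matY_jacobi

end Axioms

/-! ### Passing to a closed subspace -/

section Restriction

variable {F R : Type*} [Field F] [AddCommGroup R] [Module F R]

namespace IsClosedSubspace

variable {d : R →ₗ[F] R} {Y : R →ₗ[F] R →ₗ[F] (ℕ →₀ R)} {X : Submodule F R}

theorem resD_pow_coe (h : IsClosedSubspace d Y X) (n : ℕ) (u : X) :
    ((h.resD ^ n) u : R) = (d ^ n) u := by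
  induction n with
  | zero => rfl
  | succ n ih => rw [pow_succ', pow_succ', Module.End.mul_apply, Module.End.mul_apply, resD_coe, ih]

theorem sum_resY_coe (h : IsClosedSubspace d Y X) (u v : X) (p : ℕ → X → X) (q : ℕ → R → R)
    (hpq : ∀ m w, (p m w : R) = q m w) :
    (((h.resY u v).sum p : X) : R) = (Y u v).sum q := by
  have hs : (h.resY u v).support = (Y u v).support := by
    ext j
    rw [Finsupp.mem_support_iff, Finsupp.mem_support_iff, ← resY_coe h, Ne, Ne,
      ZeroMemClass.coe_eq_zero]
  rw [Finsupp.sum, Finsupp.sum, hs, AddSubmonoidClass.coe_finsetSum]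
  exact sum_congr rfl fun j _ => by rw [hpq, resY_coe]

theorem isConformalAlgebra (h : IsClosedSubspace d Y X) (hY : IsConformalAlgebra d Y) :
    IsConformalAlgebra h.resD h.resY where
  deriv_zero u v := Subtype.ext (hY.deriv_zero u v)
  deriv_succ u v j := Subtype.ext (hY.deriv_succ u v j)
  skew u v j := Subtype.ext <| by
    rw [resY_coe, hY.skew]
    refine (sum_resY_coe h v u _ _ fun m w => ?_).symm
    split_ifs
    · rw [SetLike.val_smul, resD_pow_coe]
    · rfl
  jacobi u v w m n := Subtype.ext <| by
    rw [AddSubgroupClass.coe_sub, resY_coe, resY_coe, resY_coe, resY_coe, hY.jacobi,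
      AddSubmonoidClass.coe_finsetSum]
    rfl

end IsClosedSubspace

end Restriction

/-! ### Brackets of polynomials divisible by Y^s -/

section Shifted

variable {F ι : Type*} [Field F]

theorem matY_el_apply [Fintype ι] (u v : Matrix ι ι F) (m₁ m₂ n₁ n₂ j : ℕ) :
    matY F ι (el u m₁ m₂) (el v n₁ n₂) j =
      (if j ≤ m₁ + m₂ + n₁ then ((-1) ^ m₂ * ((n₁ + m₂).choose m₂ : F) *
        ((m₁ + m₂ + n₁ - j).choose m₁ : F)) • el (u * v) (m₁ + m₂ + n₁ - j) n₂ else 0) -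
      (if j ≤ m₁ + m₂ + n₂ then ((-1) ^ m₁ * ((n₂ + m₁).choose m₁ : F) *
        ((m₁ + m₂ + n₂ - j).choose m₂ : F)) • el (v * u) n₁ (m₁ + m₂ + n₂ - j) else 0) := by
  have aux : ∀ (A : ℕ) (g : ℕ → Mat F ι), (∑ p ∈ range (A + 1), if A - p = j then g p else 0) =
      if j ≤ A then g (A - j) else 0 := by
    intro A g
    split_ifs with h
    · rw [sum_eq_single (A - j)]
      · rw [if_pos (by omega)]
      · intro b hb hne
        rw [if_neg]
        have := mem_range.1 hb
        omega
      · intro hn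
        exact absurd (mem_range.2 (by omega)) hn
    · refine sum_eq_zero fun p hp => ?_
      rw [if_neg]
      omega
  rw [matY_el, choose_neg_sub_one, choose_neg_sub_one, Finsupp.sub_apply, Finsupp.smul_apply,
    Finsupp.smul_apply, Finsupp.finsetSum_apply, Finsupp.finsetSum_apply]
  simp only [Finsupp.smul_apply, Finsupp.single_apply, smul_ite, smul_zero]
  rw [aux, aux]
  simp only [smul_ite, smul_smul, smul_zero]

/-- Up to the factor `m! n! s!`, the monomial `u X^m Y^(n+s)`. -/
def shiftEl (F ι : Type*) [Field F] (s m n : ℕ) : Matrix ι ι F →ₗ[F] Mat F ι :=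
  ((n + s).choose s : F) • elL F ι m (n + s)

theorem shiftEl_apply (s m n : ℕ) (u : Matrix ι ι F) :
    shiftEl F ι s m n u = ((n + s).choose s : F) • el u m (n + s) := rfl

/-- The trinomial coefficient `(a + s + b)! / (a! s! b!)`. -/
def trinom (F : Type*) [Field F] (s a b : ℕ) : F :=
  ((b + s).choose s : F) * ((b + s + a).choose a : F)

theorem trinom_eq [CharZero F] (s a b : ℕ) : trinom F s a b =
    (((a + s + b)! : ℕ) : F) * (((a ! : ℕ) : F)⁻¹ * ((s ! : ℕ) : F)⁻¹ * ((b ! : ℕ) : F)⁻¹) := by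
  rw [trinom, Nat.cast_choose F (Nat.le_add_left s b), Nat.cast_choose F (Nat.le_add_left a (b + s)),
    Nat.add_sub_cancel, Nat.add_sub_cancel, show b + s + a = a + s + b by ring]
  have h : (((b + s)! : ℕ) : F) ≠ 0 := by exact_mod_cast Nat.factorial_ne_zero _
  field_simp

theorem trinom_comm [CharZero F] (s a b : ℕ) : trinom F s a b = trinom F s b a := by
  rw [trinom_eq, trinom_eq, show a + s + b = b + s + a by ring]
  ring

variable [Fintype ι]

/-- The contribution of the product `u v` to a coefficient of `Y⁺`. -/
def leftTerm (s j m₁ n₁ m₂ n₂ : ℕ) (u v : Matrix ι ι F) : Mat F ι :=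
  if j ≤ m₁ + n₁ + s + m₂ then ((-1) ^ (n₁ + s) * trinom F s n₁ m₂ *
    ((m₁ + n₁ + s + m₂ - j).choose m₁ : F)) • shiftEl F ι s (m₁ + n₁ + s + m₂ - j) n₂ (u * v) else 0

/-- The contribution of the product `v u` to a coefficient of `Y⁺`. -/
def rightTerm (s j m₁ n₁ m₂ n₂ : ℕ) (u v : Matrix ι ι F) : Mat F ι :=
  if j ≤ m₁ + n₁ + s + n₂ then ((-1) ^ m₁ * trinom F s m₁ n₂ *
    ((m₁ + n₁ + s + n₂ - j).choose n₁ : F)) • shiftEl F ι s m₂ (m₁ + n₁ + s + n₂ - j) (v * u) else 0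

theorem matY_shiftEl_apply [CharZero F] (s j m₁ n₁ m₂ n₂ : ℕ) (u v : Matrix ι ι F) :
    matY F ι (shiftEl F ι s m₁ n₁ u) (shiftEl F ι s m₂ n₂ v) j =
      leftTerm s j m₁ n₁ m₂ n₂ u v - rightTerm s j m₁ n₁ m₂ n₂ u v := by
  rw [shiftEl_apply, shiftEl_apply, map_smul, map_smul, LinearMap.smul_apply, Finsupp.smul_apply,
    Finsupp.smul_apply, matY_el_apply, smul_sub, smul_sub]
  congr 1
  · rw [leftTerm, show m₁ + (n₁ + s) + m₂ = m₁ + n₁ + s + m₂ by ring]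
    split_ifs with h
    · rw [shiftEl_apply, smul_smul, smul_smul, smul_smul, trinom_comm, trinom]
      congr 1
      rw [show (m₂ + (n₁ + s)).choose (n₁ + s) = (n₁ + s + m₂).choose m₂ by
        rw [add_comm m₂, Nat.choose_symm_add]]
      ring
    · simp
  · rw [rightTerm]
    by_cases h : j ≤ m₁ + n₁ + s + n₂
    · rw [if_pos h, if_pos (by omega), shiftEl_apply, smul_smul, smul_smul, smul_smul,
        show m₁ + (n₁ + s) + (n₂ + s) - j = m₁ + n₁ + s + n₂ - j + s by omega]
      congr 1
      set q := m₁ + n₁ + s + n₂ - j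
      -- The subset-of-a-subset identity moves the normalising binomial from the input onto the
      -- output monomial; both sides vanish when n₁ > q.
      have hq : (q + s).choose (n₁ + s) * (n₁ + s).choose s = (q + s).choose s * q.choose n₁ := by
        rcases le_or_gt n₁ q with hle | hlt
        · rw [Nat.choose_mul (by omega), Nat.add_sub_cancel, Nat.add_sub_cancel]
        · rw [Nat.choose_eq_zero_of_lt (by omega), Nat.choose_eq_zero_of_lt hlt, zero_mul, mul_zero]
      have hq' : ((q + s).choose (n₁ + s) : F) * ((n₁ + s).choose s : F) =
          ((q + s).choose s : F) * (q.choose n₁ : F) := by exact_mod_cast hq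
      rw [trinom]
      linear_combination ((n₂ + s).choose s : F) * (-1) ^ m₁ * ((n₂ + s + m₁).choose m₁ : F) * hq'
    · rw [if_neg h]
      split_ifs with h'
      -- Here the output would have t₂-exponent below s; its binomial coefficient is 0, which is why
      -- divisibility by Y^s is preserved.
      · rw [Nat.choose_eq_zero_of_lt (show m₁ + (n₁ + s) + (n₂ + s) - j < n₁ + s by omega)]
        simp
      · simp

end Shifted

/-! ### The twisted spans and their closure under the operations -/

section Twist

variable {F ι : Type*} [Field F]

/-- The element `f + ε τ(f)` for `f = shiftEl s m n u`, where `τ` exchanges the two exponents and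
applies `σ` to the matrix. -/
def twistEl (s : ℕ) (ε : F) (σ : Matrix ι ι F →ₗ[F] Matrix ι ι F) (m n : ℕ) :
    Matrix ι ι F →ₗ[F] Mat F ι :=
  shiftEl F ι s m n + ε • shiftEl F ι s n m ∘ₗ σ

theorem twistEl_apply (s : ℕ) (ε : F) (σ : Matrix ι ι F →ₗ[F] Matrix ι ι F) (m n : ℕ)
    (u : Matrix ι ι F) :
    twistEl s ε σ m n u = shiftEl F ι s m n u + ε • shiftEl F ι s n m (σ u) := rfl

/-- The span of the elements `twistEl s ε σ m n u`. -/
def twistSpan (s : ℕ) (ε : F) (σ : Matrix ι ι F →ₗ[F] Matrix ι ι F) : Submodule F (Mat F ι) :=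
  Submodule.span F {x | ∃ (u : Matrix ι ι F) (m n : ℕ), x = twistEl s ε σ m n u}

theorem twistEl_mem (s : ℕ) (ε : F) (σ : Matrix ι ι F →ₗ[F] Matrix ι ι F) (m n : ℕ)
    (u : Matrix ι ι F) : twistEl s ε σ m n u ∈ twistSpan s ε σ :=
  Submodule.subset_span ⟨u, m, n, rfl⟩

theorem twistEl_zero (s : ℕ) (σ : Matrix ι ι F →ₗ[F] Matrix ι ι F) (m n : ℕ) :
    twistEl s 0 σ m n = shiftEl F ι s m n := by
  ext1 u
  rw [twistEl_apply, zero_smul, add_zero]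

theorem matSub_eq_twistSpan [CharZero F] (σ : Matrix ι ι F →ₗ[F] Matrix ι ι F) (ℓ : ℕ) :
    matSub F ι ℓ = twistSpan (ℓ - 1) 0 σ := by
  refine le_antisymm (Submodule.span_le.2 ?_) (Submodule.span_le.2 ?_)
  · rintro x ⟨u, m, n, rfl⟩
    have h := twistEl_mem (ℓ - 1) 0 σ m n u
    rw [twistEl_zero, shiftEl_apply] at h
    refine (Submodule.smul_mem_iff _ ?_).1 h
    exact_mod_cast (Nat.choose_pos (by omega)).ne'
  · rintro x ⟨u, m, n, rfl⟩
    rw [twistEl_zero, shiftEl_apply]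
    exact Submodule.smul_mem _ _ (Submodule.subset_span ⟨u, m, n, rfl⟩)

theorem matTwist_eq_twistSpan (σ : Matrix ι ι F →ₗ[F] Matrix ι ι F) (ℓ : ℕ) :
    matTwist σ ℓ = twistSpan (ℓ - 1) (-(-1) ^ (ℓ - 1)) σ := by
  have h : ∀ (u : Matrix ι ι F) (m n : ℕ), twistEl (ℓ - 1) (-(-1) ^ (ℓ - 1)) σ m n u =
      ((n + (ℓ - 1)).choose (ℓ - 1) : F) • el u m (n + (ℓ - 1))
        - ((-1 : F) ^ (ℓ - 1) * ((m + (ℓ - 1)).choose (ℓ - 1) : F)) • el (σ u) n (m + (ℓ - 1)) := by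
    intro u m n
    rw [twistEl_apply, shiftEl_apply, shiftEl_apply, smul_smul, sub_eq_add_neg, ← neg_smul, neg_mul]
  rw [matTwist, twistSpan]
  simp only [h]

theorem matD_shiftEl [CharZero F] (s m n : ℕ) (u : Matrix ι ι F) :
    matD F ι (shiftEl F ι s m n u) = ((m : F) + 1) • shiftEl F ι s (m + 1) n u +
      ((n : F) + 1) • shiftEl F ι s m (n + 1) u := by
  have h : (((n + s : ℕ) : F) + 1) * ((n + s).choose s : F) =
      ((n : F) + 1) * ((n + 1 + s).choose s : F) := by
    have h1 := Nat.add_one_mul_choose_eq (n + s) n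
    rw [show (n + s + 1) = n + 1 + s by ring, Nat.choose_symm_add, Nat.choose_symm_add] at h1
    have h2 : ((n + 1 + s : ℕ) : F) * ((n + s).choose s : F) =
      ((n + 1 + s).choose s : F) * ((n + 1 : ℕ) : F) := by exact_mod_cast h1
    push_cast at h2 ⊢
    linear_combination h2
  rw [shiftEl_apply, map_smul, matD_el, smul_add, shiftEl_apply, shiftEl_apply]
  simp only [smul_smul]
  rw [mul_comm, mul_comm ((n + s).choose s : F), h, show n + s + 1 = n + 1 + s by ring]

theorem matD_twistEl [CharZero F] (s : ℕ) (ε : F) (σ : Matrix ι ι F →ₗ[F] Matrix ι ι F) (m n : ℕ)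
    (u : Matrix ι ι F) : matD F ι (twistEl s ε σ m n u) =
      ((m : F) + 1) • twistEl s ε σ (m + 1) n u + ((n : F) + 1) • twistEl s ε σ m (n + 1) u := by
  simp only [twistEl_apply, map_add, map_smul, matD_shiftEl, smul_add, smul_smul]
  rw [mul_comm ε, mul_comm ε]
  abel

theorem ev_shiftEl [CharZero F] (s m n : ℕ) (u : Matrix ι ι F) (x y : F) :
    ev x y (shiftEl F ι s m n u) = (y ^ s * ((s ! : ℕ) : F)⁻¹ *
      ((x ^ m * ((m ! : ℕ) : F)⁻¹) * (y ^ n * ((n ! : ℕ) : F)⁻¹))) • u := by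
  rw [shiftEl_apply, map_smul, ev_el, smul_smul]
  congr 1
  rw [Nat.cast_choose F (Nat.le_add_left s n), Nat.add_sub_cancel, pow_add]
  have h : (((n + s)! : ℕ) : F) ≠ 0 := by exact_mod_cast Nat.factorial_ne_zero _
  field_simp

variable [Fintype ι]

/-- Compatibility of `ε` with the exponent `s`: either there is no twist, or its sign is the one
for which the twisted elements are closed under the bracket. -/
def IsTwistSign (s : ℕ) (ε : F) : Prop := ε = 0 ∨ ε = -(-1) ^ s

/-- An involutive anti-automorphism of the matrix algebra. -/
structure IsAntiInvolution (σ : Matrix ι ι F →ₗ[F] Matrix ι ι F) : Prop where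
  map_mul : ∀ u v, σ (u * v) = σ v * σ u
  map_map : ∀ u, σ (σ u) = u

theorem IsAntiInvolution.map_one [DecidableEq ι] {σ : Matrix ι ι F →ₗ[F] Matrix ι ι F}
    (hσ : IsAntiInvolution σ) : σ 1 = 1 := by
  have := hσ.map_mul (σ 1) 1
  rwa [mul_one, hσ.map_map, mul_one, eq_comm] at this

/-- Since σ reverses products, exchanging the exponents and applying σ to both factors turns the
left contribution into the right one. The binomial coefficients agree and the signs differ by
(-1)^s, so the difference is a multiple of a single generator. -/
theorem leftTerm_twist_mem (s j m₁ n₁ m₂ n₂ : ℕ) (u v : Matrix ι ι F) [CharZero F]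
    {σ : Matrix ι ι F →ₗ[F] Matrix ι ι F} (hσ : IsAntiInvolution σ) :
    leftTerm s j m₁ n₁ m₂ n₂ u v - rightTerm s j n₁ m₁ n₂ m₂ (σ u) (σ v) ∈
      twistSpan s (-(-1) ^ s) σ := by
  rw [leftTerm, rightTerm, show n₁ + m₁ + s + m₂ = m₁ + n₁ + s + m₂ by ring]
  split_ifs with h
  · rw [← hσ.map_mul]
    convert (twistSpan s (-(-1) ^ s) σ).smul_mem ((-1) ^ (n₁ + s) * trinom F s n₁ m₂ *
      ((m₁ + n₁ + s + m₂ - j).choose m₁ : F)) (twistEl_mem s _ σ (m₁ + n₁ + s + m₂ - j) n₂ (u * v))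
      using 1
    rw [twistEl_apply, smul_add, smul_smul, sub_eq_add_neg, ← neg_smul]
    congr 2
    have : ((-1 : F) ^ s) * (-1) ^ s = 1 := by rw [← mul_pow]; simp
    rw [pow_add]
    linear_combination ((-1) ^ n₁ * trinom F s n₁ m₂ * ((m₁ + n₁ + s + m₂ - j).choose m₁ : F)) * this
  · simp

theorem isClosedSubspace_twistSpan [CharZero F] (s : ℕ) {ε : F} (hε : IsTwistSign s ε)
    {σ : Matrix ι ι F →ₗ[F] Matrix ι ι F} (hσ : IsAntiInvolution σ) :
    IsClosedSubspace (matD F ι) (matY F ι) (twistSpan s ε σ) where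
  d_mem u hu := by
    induction hu using Submodule.span_induction with
    | mem x hx =>
      obtain ⟨u, m, n, rfl⟩ := hx
      rw [matD_twistEl]
      exact add_mem (Submodule.smul_mem _ _ (twistEl_mem _ _ _ _ _ _))
        (Submodule.smul_mem _ _ (twistEl_mem _ _ _ _ _ _))
    | zero => simp
    | add x y _ _ hx hy => rw [map_add]; exact add_mem hx hy
    | smul a x _ hx => rw [map_smul]; exact Submodule.smul_mem _ _ hx
  Y_mem u hu v hv j := by
    induction hu using Submodule.span_induction with
    | zero => simp
    | add x y _ _ hx hy => rw [map_add, LinearMap.add_apply, Finsupp.add_apply]; exact add_mem hx hy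
    | smul a x _ hx =>
      rw [map_smul, LinearMap.smul_apply, Finsupp.smul_apply]; exact Submodule.smul_mem _ _ hx
    | mem x hx =>
      obtain ⟨u, m₁, n₁, rfl⟩ := hx
      induction hv using Submodule.span_induction with
      | zero => simp
      | add x y _ _ hx hy => rw [map_add, Finsupp.add_apply]; exact add_mem hx hy
      | smul a x _ hx => rw [map_smul, Finsupp.smul_apply]; exact Submodule.smul_mem _ _ hx
      | mem y hy =>
        obtain ⟨v, m₂, n₂, rfl⟩ := hy
        rcases hε with rfl | rfl
        · rw [twistEl_zero, twistEl_zero, matY_shiftEl_apply, leftTerm, rightTerm]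
          refine sub_mem ?_ ?_ <;> split_ifs
          · rw [← twistEl_zero s σ]
            exact Submodule.smul_mem _ _ (twistEl_mem _ _ _ _ _ _)
          · exact zero_mem _
          · rw [← twistEl_zero s σ]
            exact Submodule.smul_mem _ _ (twistEl_mem _ _ _ _ _ _)
          · exact zero_mem _
        · have h1 := leftTerm_twist_mem s j m₁ n₁ m₂ n₂ u v hσ
          -- The bracket of two twisted generators has four left and four right terms. The left term
          -- of each pair of arguments is matched with the right term of the pair with σ applied to
          -- both; ε² = 1 makes the coefficients agree.
          have h2 := leftTerm_twist_mem s j n₁ m₁ m₂ n₂ (σ u) v hσ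
          have h3 := leftTerm_twist_mem s j m₁ n₁ n₂ m₂ u (σ v) hσ
          have h4 := leftTerm_twist_mem s j n₁ m₁ n₂ m₂ (σ u) (σ v) hσ
          simp only [hσ.map_map] at h2 h3 h4
          have h5 := add_mem (add_mem h1 h4) (Submodule.smul_mem _ (-(-1) ^ s) (add_mem h2 h3))
          convert h5 using 1
          have hs : ((-1 : F) ^ s) * (-1) ^ s = 1 := by rw [← mul_pow]; simp
          rw [twistEl_apply, twistEl_apply]
          simp only [map_add, map_smul, LinearMap.add_apply, LinearMap.smul_apply,
            Finsupp.add_apply, Finsupp.smul_apply, matY_shiftEl_apply, smul_add, smul_smul,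
            neg_mul_neg, hs, one_smul, smul_sub]
          abel

end Twist

/-! ### Weights, freeness over F[∂] and finite growth -/

section Grading

variable {F ι : Type*} [Field F]

theorem el_mem_matGrading (u : Matrix ι ι F) (m n : ℕ) : el u m n ∈ matGrading F ι (m + n + 1) :=
  Submodule.subset_span ⟨u, m, n, rfl, rfl⟩

/-- The operator that multiplies the elements of weight `n` by `n`. -/
def weightOp (F ι : Type*) [Field F] : Mat F ι →ₗ[F] Mat F ι :=
  extend fun p => ((p.1 + p.2 + 1 : ℕ) : F) • elL F ι p.1 p.2

theorem weightOp_of_mem {n : ℕ} {x : Mat F ι} (hx : x ∈ matGrading F ι n) :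
    weightOp F ι x = (n : F) • x := by
  induction hx using Submodule.span_induction with
  | mem x hx =>
    obtain ⟨u, m₁, m₂, rfl, rfl⟩ := hx
    rw [weightOp, extend_el]
    rfl
  | zero => simp
  | add x y _ _ hx hy => rw [map_add, hx, hy, smul_add]
  | smul a x _ hx => rw [map_smul, hx, smul_comm]

/-- The projection onto the homogeneous component of weight `n`. -/
def weightProj (F ι : Type*) [Field F] (n : ℕ) : Mat F ι →ₗ[F] Mat F ι :=
  extend fun p => if p.1 + p.2 + 1 = n then elL F ι p.1 p.2 else 0

theorem weightProj_of_mem {n m : ℕ} {x : Mat F ι} (hx : x ∈ matGrading F ι m) :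
    weightProj F ι n x = if m = n then x else 0 := by
  induction hx using Submodule.span_induction with
  | mem x hx =>
    obtain ⟨u, m₁, m₂, rfl, rfl⟩ := hx
    rw [weightProj, extend_el]
    dsimp only
    split_ifs <;> rfl
  | zero => simp
  | add x y _ _ hx hy => rw [map_add, hx, hy]; split_ifs <;> simp
  | smul a x _ hx => rw [map_smul, hx]; split_ifs <;> simp

theorem matY_weight [Fintype ι] (l n i : ℕ) {u v : Mat F ι} (hu : u ∈ matGrading F ι l)
    (hv : v ∈ matGrading F ι n) :
    (∀ r, n + l = r + i + 1 → matY F ι u v i ∈ matGrading F ι r) ∧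
      (n + l < i + 1 → matY F ι u v i = 0) := by
  induction hu using Submodule.span_induction with
  | zero => simp
  | add x y _ _ hx hy =>
    simp only [map_add, LinearMap.add_apply, Finsupp.add_apply]
    exact ⟨fun r h => add_mem (hx.1 r h) (hy.1 r h), fun h => by rw [hx.2 h, hy.2 h, add_zero]⟩
  | smul a x _ hx =>
    simp only [map_smul, LinearMap.smul_apply, Finsupp.smul_apply]
    exact ⟨fun r h => Submodule.smul_mem _ _ (hx.1 r h), fun h => by rw [hx.2 h, smul_zero]⟩
  | mem x hx =>
    obtain ⟨u, m₁, m₂, rfl, rfl⟩ := hx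
    induction hv using Submodule.span_induction with
    | zero => simp
    | add x y _ _ hx hy =>
      simp only [map_add, Finsupp.add_apply]
      exact ⟨fun r h => add_mem (hx.1 r h) (hy.1 r h), fun h => by rw [hx.2 h, hy.2 h, add_zero]⟩
    | smul a x _ hx =>
      simp only [map_smul, Finsupp.smul_apply]
      exact ⟨fun r h => Submodule.smul_mem _ _ (hx.1 r h), fun h => by rw [hx.2 h, smul_zero]⟩
    | mem y hy =>
      obtain ⟨v, n₁, n₂, rfl, rfl⟩ := hy
      rw [matY_el_apply]
      constructor
      · intro r hr
        refine sub_mem ?_ ?_ <;> split_ifs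
        · convert Submodule.smul_mem _ _ (el_mem_matGrading _ _ _) using 2
          omega
        · exact zero_mem _
        · convert Submodule.smul_mem _ _ (el_mem_matGrading _ _ _) using 2
          omega
        · exact zero_mem _
      · intro hi
        have e1 : m₁ + m₂ + n₁ + n₂ + 1 < i := by omega
        rw [if_neg (by omega), if_neg (by omega), sub_zero]

theorem shiftEl_mem_matGrading (s m n : ℕ) (u : Matrix ι ι F) :
    shiftEl F ι s m n u ∈ matGrading F ι (m + n + s + 1) := by
  have := el_mem_matGrading u m (n + s)
  rw [← add_assoc] at this
  exact Submodule.smul_mem _ _ this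

variable (s : ℕ) (ε : F) (σ : Matrix ι ι F →ₗ[F] Matrix ι ι F)

theorem twistEl_mem_matGrading (m n : ℕ) (u : Matrix ι ι F) :
    twistEl s ε σ m n u ∈ matGrading F ι (m + n + s + 1) := by
  refine add_mem (shiftEl_mem_matGrading s m n u) (Submodule.smul_mem _ _ ?_)
  rw [add_comm m n]
  exact shiftEl_mem_matGrading s n m _

/-- `twistEl` with values in the subspace `twistSpan`. -/
def twistGen (m n : ℕ) : Matrix ι ι F →ₗ[F] twistSpan s ε σ :=
  (twistEl s ε σ m n).codRestrict _ fun u => twistEl_mem s ε σ m n u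

theorem twistGen_coe (m n : ℕ) (u : Matrix ι ι F) :
    (twistGen s ε σ m n u : Mat F ι) = twistEl s ε σ m n u := rfl

variable {s ε σ}

theorem eq_top_of_twistGen_mem (W : Submodule F (twistSpan s ε σ))
    (h : ∀ u m n, twistGen s ε σ m n u ∈ W) : W = ⊤ := by
  have h1 : twistSpan s ε σ ≤ W.map (twistSpan s ε σ).subtype := by
    refine Submodule.span_le.2 ?_
    rintro x ⟨u, m, n, rfl⟩
    exact ⟨_, h u m n, rfl⟩
  rw [eq_top_iff]
  rintro ⟨x, hx⟩ -
  obtain ⟨y, hy, hyx⟩ := h1 hx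
  have : y = ⟨x, hx⟩ := Subtype.ext hyx
  rwa [← this]

theorem minimalWeight_lower {n : ℕ} (h : twistSpan s ε σ ⊓ matGrading F ι n ≠ ⊥) : s + 1 ≤ n := by
  obtain ⟨x, ⟨hx, hxn⟩, hne⟩ := Submodule.exists_mem_ne_zero_of_ne_bot h
  by_contra hn
  refine hne ?_
  have h1 : twistSpan s ε σ ≤ LinearMap.ker (weightProj F ι n) := by
    refine Submodule.span_le.2 ?_
    rintro x ⟨u, a, b, rfl⟩
    rw [SetLike.mem_coe, LinearMap.mem_ker, weightProj_of_mem (twistEl_mem_matGrading s ε σ a b u),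
      if_neg (by omega)]
  rw [← LinearMap.mem_ker.1 (h1 hx), weightProj_of_mem hxn, if_pos rfl]

/-- The generators of lowest weight are (u + ε σ(u)) ⊗ t₂^s. They all vanish exactly when ε σ = -1,
as happens for 1×1 matrices with s even. -/
theorem hasMinimalWeight_twistSpan {u : Matrix ι ι F} (hu : u + ε • σ u ≠ 0) :
    HasMinimalWeight (matGrading F ι) (twistSpan s ε σ) (s + 1) := by
  refine ⟨?_, fun n hn => minimalWeight_lower hn⟩
  have h1 : twistEl s ε σ 0 0 u ∈ twistSpan s ε σ ⊓ matGrading F ι (s + 1) := by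
    refine ⟨twistEl_mem s ε σ 0 0 u, ?_⟩
    have := twistEl_mem_matGrading s ε σ 0 0 u
    rwa [show 0 + 0 + s + 1 = s + 1 by ring] at this
  intro hb
  rw [hb, Submodule.mem_bot, twistEl_apply, shiftEl_apply, shiftEl_apply, zero_add, Nat.choose_self,
    Nat.cast_one, one_smul, one_smul, el_eq, el_eq, ← map_smul, ← map_add] at h1
  have h2 := congrArg (Mat.coeffs F ι) h1
  rw [← el_eq, coeffs_el, map_zero, Finsupp.single_eq_zero] at h2
  exact hu h2

theorem isWeighted_twistSpan [CharZero F] [Fintype ι]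
    (h : IsClosedSubspace (matD F ι) (matY F ι) (twistSpan s ε σ)) :
    IsWeighted h.resY (inducedGrading (matGrading F ι) (twistSpan s ε σ)) where
  internal := by
    apply DirectSum.isInternal_submodule_of_iSupIndep_of_iSup_eq_top
    · have hX : ∀ x ∈ twistSpan s ε σ, weightOp F ι x ∈ twistSpan s ε σ := by
        intro x hx
        induction hx using Submodule.span_induction with
        | mem x hx =>
          obtain ⟨u, m, n, rfl⟩ := hx
          rw [weightOp_of_mem (twistEl_mem_matGrading s ε σ m n u)]
          exact Submodule.smul_mem _ _ (twistEl_mem _ _ _ _ _ _)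
        | zero => simp
        | add x y _ _ hx hy => rw [map_add]; exact add_mem hx hy
        | smul a x _ hx => rw [map_smul]; exact Submodule.smul_mem _ _ hx
      -- Weight spaces lie in eigenspaces of the weight operator, and distinct weights stay distinct
      -- eigenvalues in characteristic 0.
      refine ((Module.End.eigenspaces_iSupIndep ((weightOp F ι).restrict hX)).comp
        (Nat.cast_injective (R := F))).mono fun n x hx => ?_
      exact Module.End.mem_eigenspace_iff.2 (Subtype.ext (weightOp_of_mem hx))
    · refine eq_top_of_twistGen_mem _ fun u m n => ?_
      exact Submodule.mem_iSup_of_mem (m + n + s + 1) (twistEl_mem_matGrading s ε σ m n u)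
  weight l n i r hr u hu v hv := (matY_weight l n i hu hv).1 r hr
  weight_neg l n i hi u hu v hv := Subtype.ext ((matY_weight l n i hu hv).2 hi)

variable (s ε σ)

/-- Up to the factor `d! s!`, the element `Y^s (X - Y)^d (u + ε (-1)^d σ(u))`. -/
def antidiagGen (d : ℕ) : Matrix ι ι F →ₗ[F] twistSpan s ε σ :=
  ∑ j ∈ range (d + 1), (-1 : F) ^ j • twistGen s ε σ (d - j) j

theorem antidiagGen_apply (d : ℕ) (u : Matrix ι ι F) :
    antidiagGen s ε σ d u = ∑ j ∈ range (d + 1), (-1 : F) ^ j • twistGen s ε σ (d - j) j u := by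
  simp [antidiagGen]

theorem antidiagGen_mem (d : ℕ) (u : Matrix ι ι F) :
    (antidiagGen s ε σ d u : Mat F ι) ∈ matGrading F ι (d + s + 1) := by
  rw [antidiagGen_apply, AddSubmonoidClass.coe_finsetSum]
  refine sum_mem fun j hj => Submodule.smul_mem _ _ ?_
  have := twistEl_mem_matGrading s ε σ (d - j) j u
  rwa [Nat.sub_add_cancel (by simpa [Nat.lt_succ_iff] using hj)] at this

theorem sum_neg_one_pow_mul [CharZero F] (d : ℕ) (x y : F) :
    ∑ j ∈ range (d + 1), (-1) ^ j * ((x ^ (d - j) * (((d - j)! : ℕ) : F)⁻¹) *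
      (y ^ j * ((j ! : ℕ) : F)⁻¹)) = (x - y) ^ d * ((d ! : ℕ) : F)⁻¹ := by
  rw [show x - y = -y + x by ring, add_pow, sum_mul]
  refine sum_congr rfl fun j hj => ?_
  rw [Nat.cast_choose F (by simpa [Nat.lt_succ_iff] using hj), neg_pow y]
  have h : ((d ! : ℕ) : F) ≠ 0 := by exact_mod_cast Nat.factorial_ne_zero _
  field_simp

theorem ev_antidiagGen [CharZero F] (d : ℕ) (u : Matrix ι ι F) (x y : F) :
    ev x y (antidiagGen s ε σ d u : Mat F ι) = y ^ s • (((s ! : ℕ) : F)⁻¹ •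
      (((x - y) ^ d * ((d ! : ℕ) : F)⁻¹) • u +
        (ε * ((-(x - y)) ^ d * ((d ! : ℕ) : F)⁻¹)) • σ u)) := by
  rw [antidiagGen_apply, AddSubmonoidClass.coe_finsetSum, map_sum, neg_sub,
    ← sum_neg_one_pow_mul d x y, ← sum_neg_one_pow_mul d y x, mul_sum, sum_smul, sum_smul,
    ← sum_add_distrib, smul_sum, smul_sum]
  refine sum_congr rfl fun j _ => ?_
  rw [SetLike.val_smul, twistGen_coe, twistEl_apply, map_smul, map_add, map_smul, ev_shiftEl,
    ev_shiftEl]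
  simp only [smul_add, smul_smul]
  congr 2 <;> ring

/-- Elements of V are Y^s times a function of X - Y. For freeness nothing more about that function
is needed. -/
theorem exists_ev_eq [CharZero F] {v : twistSpan s ε σ}
    (hv : v ∈ ⨆ d, LinearMap.range (antidiagGen s ε σ d)) :
    ∃ p : F → Matrix ι ι F, ∀ x y, ev x y (v : Mat F ι) = y ^ s • p (x - y) := by
  induction hv using Submodule.iSup_induction' with
  | mem d v hv =>
    obtain ⟨u, rfl⟩ := hv
    exact ⟨fun t => ((s ! : ℕ) : F)⁻¹ • ((t ^ d * ((d ! : ℕ) : F)⁻¹) • u +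
      (ε * ((-t) ^ d * ((d ! : ℕ) : F)⁻¹)) • σ u), fun x y => ev_antidiagGen s ε σ d u x y⟩
  | zero => exact ⟨0, fun x y => by simp⟩
  | add v w _ _ hv hw =>
    obtain ⟨p, hp⟩ := hv
    obtain ⟨q, hq⟩ := hw
    exact ⟨p + q, fun x y => by rw [Submodule.coe_add, map_add, hp, hq, Pi.add_apply, smul_add]⟩

variable {s ε σ}

/-- Modulo the image of X + Y one has Y ≡ -X, so (X-Y)^(d+1) ≡ 2^(d+1) X^(d+1). By induction on the
degree, `W` contains ∂ of everything in degree d, hence all generators of degree d + 1 reduce to the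
one with exponents (d+1, 0), and the antidiagonal element supplies a nonzero multiple of that one.
-/
theorem twistGen_mem_of_antidiagGen_mem [CharZero F] [Fintype ι]
    (h : IsClosedSubspace (matD F ι) (matY F ι) (twistSpan s ε σ))
    (W : Submodule F (twistSpan s ε σ)) (hd : ∀ w ∈ W, h.resD w ∈ W)
    (hW : ∀ d u, antidiagGen s ε σ d u ∈ W) (d : ℕ) :
    ∀ m n, m + n = d → ∀ u, twistGen s ε σ m n u ∈ W := by
  induction d with
  | zero =>
    intro m n hmn u
    obtain ⟨rfl, rfl⟩ : m = 0 ∧ n = 0 := by omega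
    have := hW 0 u
    rw [antidiagGen_apply] at this
    simpa using this
  | succ d ih =>
    have hrel : ∀ j ≤ d, ∀ u, ((d - j : ℕ) + 1 : F) • twistGen s ε σ (d + 1 - j) j u +
        ((j : F) + 1) • twistGen s ε σ (d + 1 - (j + 1)) (j + 1) u ∈ W := by
      intro j hj u
      have := hd _ (ih (d - j) j (by omega) u)
      convert this using 1
      apply Subtype.ext
      rw [IsClosedSubspace.resD_coe, twistGen_coe, matD_twistEl]
      rw [show d + 1 - j = d - j + 1 by omega, show d + 1 - (j + 1) = d - j by omega]
      rfl
    have hj : ∀ j ≤ d + 1, ∀ u, twistGen s ε σ (d + 1 - j) j u -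
        ((-1) ^ j * ((d + 1).choose j : F)) • twistGen s ε σ (d + 1) 0 u ∈ W := by
      intro j
      induction j with
      | zero => intro _ u; simp
      | succ j ihj =>
        intro hjd u
        have h1 := W.sub_mem (hrel j (by omega) u)
          (W.smul_mem ((d - j : ℕ) + 1 : F) (ihj (by omega) u))
        have hne : ((j : F) + 1) ≠ 0 := by exact_mod_cast j.succ_ne_zero
        refine (W.smul_mem_iff hne).1 ?_
        convert h1 using 1
        have hc : ((d + 1).choose (j + 1) : F) * ((j : F) + 1) =
            ((d + 1).choose j : F) * ((d - j : ℕ) + 1 : F) := by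
          have := Nat.choose_succ_right_eq (d + 1) j
          rw [show d + 1 - j = d - j + 1 by omega] at this
          exact_mod_cast this
        rw [smul_sub, smul_sub, smul_smul, smul_smul]
        have e : ((j : F) + 1) * ((-1) ^ (j + 1) * ((d + 1).choose (j + 1) : F)) =
            -(((d - j : ℕ) + 1 : F) * ((-1) ^ j * ((d + 1).choose j : F))) := by
          rw [pow_succ]
          linear_combination (-(-1) ^ j) * hc
        rw [e, neg_smul]
        abel
    have h0 : ∀ u, twistGen s ε σ (d + 1) 0 u ∈ W := by
      intro u
      have h1 := hW (d + 1) u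
      have h2 : ∑ j ∈ range (d + 1 + 1), (-1 : F) ^ j • (twistGen s ε σ (d + 1 - j) j u -
          ((-1) ^ j * ((d + 1).choose j : F)) • twistGen s ε σ (d + 1) 0 u) ∈ W :=
        sum_mem fun j hjr => W.smul_mem _ (hj j (by simpa [Nat.lt_succ_iff] using hjr) u)
      have h3 := W.sub_mem h1 h2
      rw [antidiagGen_apply, ← sum_sub_distrib] at h3
      have h4 : ∑ j ∈ range (d + 1 + 1), ((-1 : F) ^ j • twistGen s ε σ (d + 1 - j) j u -
          (-1 : F) ^ j • (twistGen s ε σ (d + 1 - j) j u -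
          ((-1) ^ j * ((d + 1).choose j : F)) • twistGen s ε σ (d + 1) 0 u)) =
          (2 : F) ^ (d + 1) • twistGen s ε σ (d + 1) 0 u := by
        rw [show (2 : F) ^ (d + 1) = ((2 ^ (d + 1) : ℕ) : F) by push_cast; rfl,
          ← Nat.sum_range_choose, Nat.cast_sum, sum_smul]
        refine sum_congr rfl fun j _ => ?_
        rw [smul_sub, sub_sub_cancel, smul_smul, ← mul_assoc, ← mul_pow]
        simp
      rw [h4] at h3
      exact (W.smul_mem_iff (pow_ne_zero _ two_ne_zero)).1 h3
    intro m n hmn u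
    have h1 := W.add_mem (hj n (by omega) u)
      (W.smul_mem ((-1) ^ n * ((d + 1).choose n : F)) (h0 u))
    rwa [sub_add_cancel, show d + 1 - n = m by omega] at h1

theorem isFreeOver_twistSpan [CharZero F] [Fintype ι]
    (h : IsClosedSubspace (matD F ι) (matY F ι) (twistSpan s ε σ)) :
    IsFreeOver h.resD (⨆ d, LinearMap.range (antidiagGen s ε σ d)) := by
  set V := ⨆ d, LinearMap.range (antidiagGen s ε σ d) with hV
  let L : (ℕ →₀ V) →ₗ[F] twistSpan s ε σ := Finsupp.lsum F fun n => (h.resD ^ n) ∘ₗ V.subtype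
  have hL : (fun f : ℕ →₀ V => f.sum fun n v => (h.resD ^ n) (v : twistSpan s ε σ)) = L := rfl
  rw [IsFreeOver, hL]
  constructor
  · rw [injective_iff_map_eq_zero]
    intro f hf
    choose p hp using fun n => exists_ev_eq s ε σ (f n).2
    obtain ⟨N, hN⟩ := exists_bound f
    have h1 : ∀ x y : F, ∑ n ∈ range N, (x + y) ^ n • y ^ s • p n (x - y) = 0 := by
      intro x y
      have h2 : ev x y ((L f : twistSpan s ε σ) : Mat F ι) = 0 := by rw [hf]; simp
      have h3 : L f = ∑ n ∈ range N, (h.resD ^ n) (f n : twistSpan s ε σ) := by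
        refine Finsupp.sum_of_support_subset _ (fun n hn => ?_) _ fun n _ => by simp
        by_contra hc
        exact Finsupp.mem_support_iff.1 hn (hN n (by simpa using hc))
      rw [h3, AddSubmonoidClass.coe_finsetSum, map_sum] at h2
      rw [← h2]
      refine sum_congr rfl fun n _ => ?_
      rw [IsClosedSubspace.resD_pow_coe, ev_matD_pow, hp]
    have h2 : ∀ n < N, ∀ D : F, p n D = 0 := by
      intro n hn D
      -- Fix D = x - y and vary S = x + y: the relation is a polynomial in S with coefficients p n
      -- D, after cancelling y^s. The point S = D is excluded because y = (S-D)/2 vanishes there.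
      refine eq_zero_of_sum_pow_smul_eq_zero N (fun n => p n D) {D} (fun S hS => ?_) n hn
      have hne : S - D ≠ 0 := sub_ne_zero.2 (by simpa using hS)
      have h3 := h1 ((S + D) / 2) ((S - D) / 2)
      have e1 : (S + D) / 2 + (S - D) / 2 = S := by ring
      have e2 : (S + D) / 2 - (S - D) / 2 = D := by ring
      rw [e1, e2] at h3
      simp only [smul_comm _ (((S - D) / 2) ^ s)] at h3
      rw [← smul_sum] at h3
      exact (smul_eq_zero.1 h3).resolve_left (pow_ne_zero _ (div_ne_zero hne two_ne_zero))
    ext1 n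
    by_cases hn : n < N
    · apply Subtype.ext
      apply Subtype.ext
      refine eq_zero_of_ev_eq_zero _ fun x y => ?_
      rw [hp, h2 n hn, smul_zero]
    · exact hN n (by omega)
  · rw [← LinearMap.range_eq_top]
    refine eq_top_of_twistGen_mem _ fun u m n => ?_
    refine twistGen_mem_of_antidiagGen_mem h _ ?_ ?_ (m + n) m n rfl u
    · rintro _ ⟨f, rfl⟩
      induction f using Finsupp.induction_linear with
      | zero => simp
      | add f g hf hg => rw [map_add, map_add]; exact add_mem hf hg
      | single n v =>
        refine ⟨Finsupp.single (n + 1) v, ?_⟩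
        simp [L, pow_succ']
    · intro d u
      have hmem : antidiagGen s ε σ d u ∈ V := Submodule.mem_iSup_of_mem d ⟨u, rfl⟩
      refine ⟨Finsupp.single 0 ⟨_, hmem⟩, ?_⟩
      simp [L]

end Grading

theorem isFiniteGrowth_twistSpan {F : Type*} [Field F] [CharZero F] {ι : Type} [Fintype ι]
    {s : ℕ} {ε : F} {σ : Matrix ι ι F →ₗ[F] Matrix ι ι F}
    (h : IsClosedSubspace (matD F ι) (matY F ι) (twistSpan s ε σ)) :
    IsFiniteGrowth h.resD h.resY (inducedGrading (matGrading F ι) (twistSpan s ε σ)) where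
  weighted := isWeighted_twistSpan h
  free := by
    refine ⟨⨆ d, LinearMap.range (antidiagGen s ε σ d), ?_, isFreeOver_twistSpan h,
      Module.finrank F (Matrix ι ι F), fun n => ?_⟩
    · refine le_antisymm (iSup_le fun d => ?_) (iSup_le fun n => inf_le_left)
      refine le_iSup_of_le (d + s + 1) (le_inf (le_iSup (fun d => LinearMap.range (antidiagGen s ε σ d)) d) ?_)
      rintro _ ⟨u, rfl⟩
      exact antidiagGen_mem s ε σ d u
    · have hle : (⨆ d, LinearMap.range (antidiagGen s ε σ d)) ⊓
          inducedGrading (matGrading F ι) (twistSpan s ε σ) n ≤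
          LinearMap.range (antidiagGen s ε σ (n - 1 - s)) := by
        rintro x ⟨hx, hxn⟩
        -- Only d = n - 1 - s has weight n. If n ≤ s the truncated subtraction gives 0, but then no
        -- d matches and the projection is 0 anyway.
        have hp : ∀ x ∈ ⨆ d, LinearMap.range (antidiagGen s ε σ d),
            ∃ u, weightProj F ι n x = antidiagGen s ε σ (n - 1 - s) u := by
          intro x hx
          induction hx using Submodule.iSup_induction' with
          | mem d v hv =>
            obtain ⟨u, rfl⟩ := hv
            rw [weightProj_of_mem (antidiagGen_mem s ε σ d u)]
            split_ifs with hd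
            · exact ⟨u, by rw [show n - 1 - s = d by omega]⟩
            · exact ⟨0, by simp⟩
          | zero => exact ⟨0, by simp⟩
          | add v w _ _ hv hw =>
            obtain ⟨a, ha⟩ := hv
            obtain ⟨b, hb⟩ := hw
            exact ⟨a + b, by rw [Submodule.coe_add, map_add, ha, hb, map_add, Submodule.coe_add]⟩
        obtain ⟨u, hu⟩ := hp x hx
        rw [weightProj_of_mem (show (x : Mat F ι) ∈ matGrading F ι n from hxn), if_pos rfl] at hu
        exact ⟨u, (Subtype.ext hu).symm⟩
      rw [Module.finrank_eq_rank]
      exact (Submodule.rank_mono hle).trans (rank_range_le _)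

/-! ### Separating terms by finite differences -/

section Differences

variable {F V : Type*} [Field F] [AddCommGroup V] [Module F V]

/-- Binomial coefficients with distinct lower indices can be separated by finite differences. -/
theorem mem_of_sum_choose_smul_mem (I : Submodule F V) (L : ℕ) :
    ∀ (A : Finset ℕ) (k b : ℕ → ℕ) (x : ℕ → V), Set.InjOn k A → (∀ n ∈ A, k n < L) →
      (∀ t : ℕ, ∑ n ∈ A, ((b n + t).choose (k n) : F) • x n ∈ I) → ∀ n ∈ A, x n ∈ I := by
  induction L with
  | zero => intro A k b x _ hL _ n hn; exact absurd (hL n hn) (by omega)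
  | succ L ih =>
    intro A k b x hk hL h
    have h1 : ∀ n ∈ A, k n ≠ 0 → x n ∈ I := by
      -- By Pascal's rule, the difference between t + 1 and t lowers each lower index by one and
      -- kills the term with lower index 0; by injectivity there is at most one such term.
      have := ih (A.filter fun n => k n ≠ 0) (fun n => k n - 1) b x ?_ ?_ ?_
      · intro n hn hk0
        exact this n (mem_filter.2 ⟨hn, hk0⟩)
      · intro p hp q hq hpq
        simp only [coe_filter, Set.mem_ofPred_eq] at hp hq
        exact hk hp.1 hq.1 (by simp only at hpq; omega)
      · intro n hn
        have := hL n (mem_filter.1 hn).1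
        have := (mem_filter.1 hn).2
        omega
      · intro t
        have h2 := I.sub_mem (h (t + 1)) (h t)
        convert h2 using 1
        rw [← sum_sub_distrib, sum_filter]
        refine sum_congr rfl fun n _ => ?_
        rw [← sub_smul]
        split_ifs with h0
        · obtain ⟨c, hc⟩ := Nat.exists_eq_succ_of_ne_zero h0
          rw [hc, ← add_assoc, Nat.succ_eq_add_one, Nat.add_sub_cancel, Nat.choose_succ_succ]
          push_cast
          rw [add_sub_cancel_right]
        · rw [not_not] at h0
          simp [h0]
    intro n hn
    by_cases h0 : k n = 0
    · have h2 := h 0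
      rw [← add_sum_erase A _ hn] at h2
      have h3 : ∑ p ∈ A.erase n, ((b p + 0).choose (k p) : F) • x p ∈ I := by
        refine sum_mem fun p hp => I.smul_mem _ (h1 p (mem_of_mem_erase hp) fun hp0 => ?_)
        exact ne_of_mem_erase hp (hk (mem_of_mem_erase hp) hn (hp0.trans h0.symm))
      have h4 := (Submodule.add_mem_iff_left I h3).1 h2
      simpa [h0] using h4
    · exact h1 n hn h0

theorem mem_of_sum_trinom_smul_mem [CharZero F] (J : Submodule F V) (s N : ℕ) (Z : ℕ → ℕ → V)
    (h : ∀ i j, s + N ≤ j → ∑ n ∈ range N,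
      (if j ≤ i + s + n then trinom F s i n • Z n (i + s + n - j) else 0) ∈ J)
    (n e : ℕ) (hn : n < N) : Z n e ∈ J := by
  have hf : ∀ k : ℕ, ((k ! : ℕ) : F) ≠ 0 := fun k => by exact_mod_cast Nat.factorial_ne_zero _
  -- Take i = e + N + t and j = s + N + t + n, so that the p-th term involves Z p (p+e-n) for every
  -- t. Up to a nonzero factor common to all p, its trinomial is ((s+e+N+p+t) choose (p+e-n))
  -- (p+e-n)!/p!, and t runs freely.
  have key := mem_of_sum_choose_smul_mem (F := F) J (N + e + 1)
    ((range N).filter fun p => n ≤ p + e) (fun p => p + e - n) (fun p => s + e + N + p)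
    (fun p => (((p + e - n)! : ℕ) * ((p ! : ℕ) : F)⁻¹ : F) • Z p (p + e - n)) ?_ ?_ ?_ n
    (mem_filter.2 ⟨mem_range.2 hn, by omega⟩)
  · rw [Nat.add_sub_cancel_left] at key
    exact (J.smul_mem_iff (mul_ne_zero (hf _) (inv_ne_zero (hf _)))).1 key
  · intro p hp q hq hpq
    simp only [coe_filter, Set.mem_ofPred_eq] at hp hq hpq
    omega
  · intro p hp
    simp only [mem_filter, mem_range] at hp
    omega
  · intro t
    have h1 := h (e + N + t) (s + N + t + n) (by omega)
    have hc : (((s + N + t + n)! : ℕ) : F) * ((((e + N + t)! : ℕ) : F)⁻¹ * ((s ! : ℕ) : F)⁻¹) ≠ 0 :=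
      mul_ne_zero (hf _) (mul_ne_zero (inv_ne_zero (hf _)) (inv_ne_zero (hf _)))
    refine (J.smul_mem_iff hc).1 ?_
    convert h1 using 1
    rw [sum_filter, smul_sum]
    refine sum_congr rfl fun p _ => ?_
    by_cases hp : n ≤ p + e
    · rw [if_pos hp, if_pos (by omega), smul_smul, smul_smul, trinom_eq,
        show e + N + t + s + p - (s + N + t + n) = p + e - n by omega,
        show s + e + N + p + t = e + N + t + s + p by ring,
        Nat.cast_choose F (show p + e - n ≤ e + N + t + s + p by omega),
        show e + N + t + s + p - (p + e - n) = s + N + t + n by omega]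
      congr 1
      have := hf (s + N + t + n)
      have := hf (p + e - n)
      field_simp
    · rw [if_neg hp, if_neg (by omega), smul_zero]

end Differences

/-! ### Simplicity -/

section Simple

variable {F ι : Type*} [Field F] [CharZero F]

omit [CharZero F] in
-- With matrix units, E_ip c E_qj = c_pq E_ij; one nonzero entry of c therefore produces every
-- matrix unit.
theorem eq_top_of_mul_mul_mem [Fintype ι] [DecidableEq ι] (W : Submodule F (Matrix ι ι F))
    {c : Matrix ι ι F} (hc : c ≠ 0) (h : ∀ a b, a * c * b ∈ W) (u : Matrix ι ι F) : u ∈ W := by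
  obtain ⟨p, q, hpq⟩ : ∃ p q, c p q ≠ 0 := by
    by_contra hn
    push Not at hn
    exact hc (Matrix.ext hn)
  rw [Matrix.matrix_eq_sum_single u]
  refine sum_mem fun i _ => sum_mem fun j _ => ?_
  have h1 := W.smul_mem (u i j * (c p q)⁻¹) (h (Matrix.single i p 1) (Matrix.single q j 1))
  convert h1 using 1
  rw [Matrix.single_mul_mul_single, Matrix.smul_single]
  congr 1
  rw [smul_eq_mul]
  field_simp

/-- The coefficient of `shiftEl s m n`. -/
def shiftCoeff (F ι : Type*) [Field F] (s m n : ℕ) : Mat F ι →ₗ[F] Matrix ι ι F :=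
  ((n + s).choose s : F)⁻¹ • Finsupp.lapply (m, n + s) ∘ₗ (Mat.coeffs F ι).toLinearMap

theorem shiftCoeff_shiftEl (s m n m' n' : ℕ) (u : Matrix ι ι F) :
    shiftCoeff F ι s m n (shiftEl F ι s m' n' u) = if m' = m ∧ n' = n then u else 0 := by
  have h1 : shiftCoeff F ι s m n (shiftEl F ι s m' n' u) = ((n + s).choose s : F)⁻¹ •
      (Mat.coeffs F ι (((n' + s).choose s : F) • el u m' (n' + s))) (m, n + s) := rfl
  rw [h1, map_smul, coeffs_el, Finsupp.smul_apply, Finsupp.single_apply]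
  by_cases h : m' = m ∧ n' = n
  · obtain ⟨rfl, rfl⟩ := h
    have hne : ((n' + s).choose s : F) ≠ 0 := by exact_mod_cast (Nat.choose_pos (by omega)).ne'
    simp [smul_smul, hne]
  · rw [if_neg h, if_neg, smul_zero, smul_zero]
    intro he
    rw [Prod.mk.injEq] at he
    omega

variable {s : ℕ} {ε : F} {σ : Matrix ι ι F →ₗ[F] Matrix ι ι F}

theorem shiftCoeff_twistEl (m n m' n' : ℕ) (u : Matrix ι ι F) :
    shiftCoeff F ι s m n (twistEl s ε σ m' n' u) =
      (if m' = m ∧ n' = n then u else 0) + ε • (if n' = m ∧ m' = n then σ u else 0) := by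
  rw [twistEl_apply, map_add, map_smul, shiftCoeff_shiftEl, shiftCoeff_shiftEl]

theorem eq_sum_shiftEl {g : Mat F ι} (hg : g ∈ twistSpan s ε σ) : ∃ N₀, ∀ N, N₀ ≤ N →
    g = ∑ m ∈ range N, ∑ n ∈ range N, shiftEl F ι s m n (shiftCoeff F ι s m n g) := by
  induction hg using Submodule.span_induction with
  | mem x hx =>
    obtain ⟨u, m', n', rfl⟩ := hx
    refine ⟨m' + n' + 1, fun N hN => ?_⟩
    have aux : ∀ a b (v : Matrix ι ι F), a < N → b < N →
        ∑ m ∈ range N, ∑ n ∈ range N, shiftEl F ι s m n (if a = m ∧ b = n then v else 0) =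
          shiftEl F ι s a b v := by
      intro a b v ha hb
      rw [sum_eq_single a, sum_eq_single b]
      · simp
      · intro n _ hn
        rw [if_neg (fun h => hn h.2.symm), map_zero]
      · intro h
        exact absurd (mem_range.2 hb) h
      · intro m _ hm
        refine sum_eq_zero fun n _ => ?_
        rw [if_neg (fun h => hm h.1.symm), map_zero]
      · intro h
        exact absurd (mem_range.2 ha) h
    simp only [shiftCoeff_twistEl, map_add, map_smul, sum_add_distrib, ← smul_sum]
    rw [aux m' n' u (by omega) (by omega), aux n' m' (σ u) (by omega) (by omega), twistEl_apply]
  | zero => exact ⟨0, fun N _ => by simp⟩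
  | add x y _ _ hx hy =>
    obtain ⟨A, hA⟩ := hx
    obtain ⟨B, hB⟩ := hy
    refine ⟨A + B, fun N hN => ?_⟩
    simp only [map_add, sum_add_distrib]
    rw [← hA N (by omega), ← hB N (by omega)]
  | smul a x _ hx =>
    obtain ⟨A, hA⟩ := hx
    refine ⟨A, fun N hN => ?_⟩
    simp only [map_smul, ← smul_sum]
    rw [← hA N hN]

theorem exists_shiftCoeff_ne_zero {g : Mat F ι} (hg : g ∈ twistSpan s ε σ) (h0 : g ≠ 0) :
    ∃ m n, shiftCoeff F ι s m n g ≠ 0 := by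
  by_contra hn
  push Not at hn
  obtain ⟨N₀, hN₀⟩ := eq_sum_shiftEl hg
  exact h0 (by rw [hN₀ N₀ le_rfl]; simp [hn])

variable [Fintype ι]

/-- This lets `column_mem` recognise products of σ(a) with the rows of g as twists of products of
its columns with a. -/
theorem shiftCoeff_symm (hσ : IsAntiInvolution σ) {g : Mat F ι}
    (hg : g ∈ twistSpan s (-(-1) ^ s) σ) (m n : ℕ) :
    shiftCoeff F ι s n m g = (-(-1) ^ s : F) • σ (shiftCoeff F ι s m n g) := by
  have hs : ((-1 : F) ^ s) * (-1) ^ s = 1 := by rw [← mul_pow]; simp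
  induction hg using Submodule.span_induction with
  | mem x hx =>
    obtain ⟨u, m', n', rfl⟩ := hx
    rw [shiftCoeff_twistEl, shiftCoeff_twistEl, map_add, map_smul, smul_add, smul_smul, neg_mul_neg,
      hs, one_smul, add_comm]
    congr 1
    · congr 1
      simp only [and_comm]
      split_ifs <;> simp
    · simp only [and_comm]
      split_ifs <;> simp [hσ.map_map]
  | zero => simp
  | add x y _ _ hx hy => rw [map_add, map_add, map_add, hx, hy, smul_add]
  | smul a x _ hx => rw [map_smul, map_smul, map_smul, hx, smul_comm]

/-- The bound on j removes the products a · G: their coefficient contains ((i+s+m-j) choose i),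
which is 0 because s + m < s + N ≤ j. -/
theorem matY_shiftEl_zero_right_sum (i j N : ℕ) (hj : s + N ≤ j) (a : Matrix ι ι F)
    (G : ℕ → ℕ → Matrix ι ι F) :
    matY F ι (shiftEl F ι s i 0 a) (∑ m ∈ range N, ∑ n ∈ range N, shiftEl F ι s m n (G m n)) j =
      -(-1 : F) ^ i • ∑ n ∈ range N, (if j ≤ i + s + n then trinom F s i n •
        ∑ m ∈ range N, shiftEl F ι s m (i + s + n - j) (G m n * a) else 0) := by
  rw [sum_comm]
  simp only [map_sum, Finsupp.finsetSum_apply, matY_shiftEl_apply]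
  rw [smul_sum]
  refine sum_congr rfl fun n hn => ?_
  have h1 : ∀ m ∈ range N, leftTerm s j i 0 m n a (G m n) - rightTerm s j i 0 m n a (G m n) =
      -(-1 : F) ^ i • (if j ≤ i + s + n then trinom F s i n •
        shiftEl F ι s m (i + s + n - j) (G m n * a) else 0) := by
    intro m hm
    have hm := mem_range.1 hm
    have hl : leftTerm s j i 0 m n a (G m n) = 0 := by
      rw [leftTerm]
      split_ifs with h
      · rw [Nat.choose_eq_zero_of_lt (by omega)]
        simp
      · rfl
    rw [hl, zero_sub, rightTerm, add_zero, Nat.choose_zero_right, Nat.cast_one, mul_one]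
    split_ifs
    · rw [smul_smul, neg_mul, neg_smul]
    · simp
  rw [sum_congr rfl h1, ← smul_sum]
  split_ifs
  · simp only [smul_sum]
  · simp

theorem matY_shiftEl_zero_left_sum (i j N : ℕ) (hj : s + N ≤ j) (b : Matrix ι ι F)
    (G : ℕ → ℕ → Matrix ι ι F) :
    matY F ι (shiftEl F ι s 0 i b) (∑ m ∈ range N, ∑ n ∈ range N, shiftEl F ι s m n (G m n)) j =
      (-1 : F) ^ (i + s) • ∑ m ∈ range N, (if j ≤ i + s + m then trinom F s i m •
        ∑ n ∈ range N, shiftEl F ι s (i + s + m - j) n (b * G m n) else 0) := by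
  simp only [map_sum, Finsupp.finsetSum_apply, matY_shiftEl_apply]
  rw [smul_sum]
  refine sum_congr rfl fun m hm => ?_
  have h1 : ∀ n ∈ range N, leftTerm s j 0 i m n b (G m n) - rightTerm s j 0 i m n b (G m n) =
      (-1 : F) ^ (i + s) • (if j ≤ i + s + m then trinom F s i m •
        shiftEl F ι s (i + s + m - j) n (b * G m n) else 0) := by
    intro n hn
    have hn := mem_range.1 hn
    have hr : rightTerm s j 0 i m n b (G m n) = 0 := by
      rw [rightTerm]
      split_ifs with h
      · rw [Nat.choose_eq_zero_of_lt (by omega)]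
        simp
      · rfl
    rw [hr, sub_zero, leftTerm, zero_add, Nat.choose_zero_right, Nat.cast_one, mul_one]
    split_ifs
    · rw [smul_smul]
    · simp
  rw [sum_congr rfl h1, ← smul_sum]
  split_ifs
  · simp only [smul_sum]
  · simp

/-- If all brackets `f_j g` lie in `J`, then so do the twists of `g_n(X) Y^e a`, where `g_n` is
the coefficient of `Y^n` in `g`. -/
theorem column_mem (hε : IsTwistSign s ε) (hσ : IsAntiInvolution σ) (J : Submodule F (Mat F ι))
    {g : Mat F ι} (hg : g ∈ twistSpan s ε σ)
    (hJ : ∀ f ∈ twistSpan s ε σ, ∀ j, matY F ι f g j ∈ J) :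
    ∃ N₀, ∀ N, N₀ ≤ N → ∀ n < N, ∀ e a,
      ∑ m ∈ range N, twistEl s ε σ m e (shiftCoeff F ι s m n g * a) ∈ J := by
  obtain ⟨N₀, hN₀⟩ := eq_sum_shiftEl hg
  refine ⟨N₀, fun N hN n hn e a => ?_⟩
  refine mem_of_sum_trinom_smul_mem J s N (fun n e => ∑ m ∈ range N,
    twistEl s ε σ m e (shiftCoeff F ι s m n g * a)) (fun i j hj => ?_) n e hn
  have h1 := hJ _ (twistEl_mem s ε σ i 0 a) j
  have hi : (-(-1 : F) ^ i) ≠ 0 := neg_ne_zero.2 (pow_ne_zero _ (neg_ne_zero.2 one_ne_zero))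
  refine (J.smul_mem_iff hi).1 ?_
  convert h1 using 1
  rw [twistEl_apply, map_add, LinearMap.add_apply, map_smul, LinearMap.smul_apply,
    Finsupp.add_apply, Finsupp.smul_apply, hN₀ N hN,
    matY_shiftEl_zero_right_sum i j N hj, ← hN₀ N hN]
  rcases hε with rfl | rfl
  · simp only [twistEl_zero, zero_smul, add_zero]
  -- The second half of the generator, ε σ(a) with exponents (0, i), gives the mirror image of the
  -- same sum with the same sign and trinomials, completing each monomial to its twist.
  · conv_rhs => rw [hN₀ N hN]
    rw [matY_shiftEl_zero_left_sum i j N hj, ← hN₀ N hN, smul_smul,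
      show (-(-1 : F) ^ s) * (-1) ^ (i + s) = -(-1) ^ i by
        have hs : ((-1 : F) ^ s) * (-1) ^ s = 1 := by rw [← mul_pow]; simp
        rw [pow_add]
        linear_combination (-(-1) ^ i) * hs,
      ← smul_add, ← sum_add_distrib]
    congr 1
    refine sum_congr rfl fun n _ => ?_
    split_ifs
    · rw [← smul_add, ← sum_add_distrib]
      congr 1
      refine sum_congr rfl fun m _ => ?_
      rw [twistEl_apply, hσ.map_mul, shiftCoeff_symm hσ hg m n, mul_smul_comm, map_smul]
    · rw [add_zero]

/-- The counterpart of `column_mem` for the rows, without a twist. -/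
theorem row_mem (J : Submodule F (Mat F ι)) {g : Mat F ι} (hg : g ∈ twistSpan s 0 σ)
    (hJ : ∀ f ∈ twistSpan s 0 σ, ∀ j, matY F ι f g j ∈ J) :
    ∃ N₀, ∀ N, N₀ ≤ N → ∀ m < N, ∀ e b,
      ∑ n ∈ range N, shiftEl F ι s e n (b * shiftCoeff F ι s m n g) ∈ J := by
  obtain ⟨N₀, hN₀⟩ := eq_sum_shiftEl hg
  refine ⟨N₀, fun N hN m hm e b => ?_⟩
  refine mem_of_sum_trinom_smul_mem J s N (fun m e => ∑ n ∈ range N,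
    shiftEl F ι s e n (b * shiftCoeff F ι s m n g)) (fun i j hj => ?_) m e hm
  have h1 := hJ _ (twistEl_mem s 0 σ 0 i b) j
  have hi : (-1 : F) ^ (i + s) ≠ 0 := pow_ne_zero _ (neg_ne_zero.2 one_ne_zero)
  refine (J.smul_mem_iff hi).1 ?_
  rw [twistEl_zero, hN₀ N hN, matY_shiftEl_zero_left_sum i j N hj] at h1
  exact h1

variable [DecidableEq ι]

/-- The column step concentrates everything at the single Y-exponent e; the row step at X-exponent
m₀ then leaves the one monomial b c a with exponents (q, e), where c is a nonzero coefficient. -/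
theorem twistSpan_le_of_untwisted (hσ : IsAntiInvolution σ) (J : Submodule F (Mat F ι))
    (hJ : J ≤ twistSpan s 0 σ) (hY : ∀ f ∈ twistSpan s 0 σ, ∀ g ∈ J, ∀ j, matY F ι f g j ∈ J)
    (hne : J ≠ ⊥) : twistSpan s 0 σ ≤ J := by
  obtain ⟨g, hg, h0⟩ := Submodule.exists_mem_ne_zero_of_ne_bot hne
  obtain ⟨m₀, n₀, hc⟩ := exists_shiftCoeff_ne_zero (hJ hg) h0
  obtain ⟨A, hA⟩ := column_mem (Or.inl rfl) hσ J (hJ hg) fun f hf => hY f hf g hg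
  have hkey : ∀ e q (u : Matrix ι ι F), shiftEl F ι s q e u ∈ J := by
    intro e q u
    refine eq_top_of_mul_mul_mem (J.comap (shiftEl F ι s q e)) hc (fun b a => ?_) u
    have h1 := hA (A + m₀ + n₀ + 1) (by omega) n₀ (by omega) e a
    simp only [twistEl_zero] at h1
    obtain ⟨B, hB⟩ := row_mem J (hJ h1) fun f hf => hY f hf _ h1
    have h2 := hB (B + m₀ + e + 1) (by omega) m₀ (by omega) q b
    rw [sum_eq_single e] at h2
    · rw [map_sum, sum_eq_single m₀] at h2
      · rw [shiftCoeff_shiftEl, if_pos ⟨rfl, rfl⟩, ← mul_assoc] at h2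
        exact h2
      · intro m _ hm
        rw [shiftCoeff_shiftEl, if_neg fun h => hm h.1]
      · intro h
        exact absurd (mem_range.2 (by omega)) h
    · intro n _ hn
      rw [map_sum, sum_eq_zero, mul_zero, map_zero]
      intro m _
      rw [shiftCoeff_shiftEl, if_neg fun h => hn h.2.symm]
    · intro h
      exact absurd (mem_range.2 (by omega)) h
  refine Submodule.span_le.2 ?_
  rintro x ⟨u, m, n, rfl⟩
  rw [twistEl_zero]
  exact hkey n m u

/-- Rows are twisted columns here, so `column_mem` is applied twice. The two halves of the
intermediate element must not overlap, which forces large exponents first. -/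
theorem twistSpan_le_of_twisted (hσ : IsAntiInvolution σ) (hε : ε = -(-1) ^ s)
    (J : Submodule F (Mat F ι)) (hJ : J ≤ twistSpan s ε σ)
    (hY : ∀ f ∈ twistSpan s ε σ, ∀ g ∈ J, ∀ j, matY F ι f g j ∈ J)
    (hne : J ≠ ⊥) : twistSpan s ε σ ≤ J := by
  have hε0 : ε ≠ 0 := by
    rw [hε]
    exact neg_ne_zero.2 (pow_ne_zero _ (neg_ne_zero.2 one_ne_zero))
  obtain ⟨g, hg, h0⟩ := Submodule.exists_mem_ne_zero_of_ne_bot hne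
  obtain ⟨m₀, n₀, hc⟩ := exists_shiftCoeff_ne_zero (hJ hg) h0
  obtain ⟨A, hA⟩ := column_mem (Or.inr hε) hσ J (hJ hg) fun f hf => hY f hf g hg
  set N := A + m₀ + n₀ + 1 with hN
  -- For e ≥ N > m₀ the coefficient of Y^m₀ sees only the twisted half, namely ε σ(c σ(a)) = ε a
  -- σ(c) at X^e.
  have hlarge : ∀ e, N ≤ e → ∀ q (u : Matrix ι ι F), twistEl s ε σ e q u ∈ J := by
    intro e he q u
    have hc' : σ (shiftCoeff F ι s m₀ n₀ g) ≠ 0 := by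
      intro h
      apply hc
      rw [← hσ.map_map (shiftCoeff F ι s m₀ n₀ g), h, map_zero]
    refine eq_top_of_mul_mul_mem (J.comap (twistEl s ε σ e q)) hc' (fun a b => ?_) u
    have h1 := hA N (by omega) n₀ (by omega) e (σ a)
    obtain ⟨B, hB⟩ := column_mem (Or.inr hε) hσ J (hJ h1) fun f hf => hY f hf _ h1
    have h2 := hB (B + m₀ + e + 1) (by omega) m₀ (by omega) q b
    simp only [map_sum, shiftCoeff_twistEl] at h2
    rw [sum_eq_single e] at h2
    · rw [sum_eq_single m₀] at h2
      · rw [if_neg (by omega), if_pos ⟨rfl, rfl⟩, zero_add, hσ.map_mul, hσ.map_map, smul_mul_assoc,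
          map_smul] at h2
        exact (J.smul_mem_iff hε0).1 h2
      · intro m _ hm
        rw [if_neg (by omega), if_neg fun h => hm h.2, smul_zero, add_zero]
      · intro h
        exact absurd (mem_range.2 (by omega)) h
    · intro p _ hp
      rw [sum_eq_zero, zero_mul, map_zero]
      intro m hm
      rw [if_neg (by omega), if_neg fun h => hp h.1.symm, smul_zero, add_zero]
    · intro h
      exact absurd (mem_range.2 (by omega)) h
  -- Start from the generator with matrix 1 and exponents (N, e), already in `J`: its Y^N-column is
  -- ε σ(1) X^e, and σ(1) = 1.
  have hsmall : ∀ e, e < N → ∀ q (u : Matrix ι ι F), twistEl s ε σ e q u ∈ J := by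
    intro e he q u
    have h1 := hlarge N le_rfl e 1
    obtain ⟨B, hB⟩ := column_mem (Or.inr hε) hσ J (hJ h1) fun f hf => hY f hf _ h1
    have h2 := hB (B + N + 1) (by omega) N (by omega) q u
    simp only [shiftCoeff_twistEl] at h2
    rw [sum_eq_single e] at h2
    · rw [if_neg (by omega), if_pos ⟨rfl, trivial⟩, zero_add, hσ.map_one, smul_mul_assoc, one_mul,
        map_smul] at h2
      exact (J.smul_mem_iff hε0).1 h2
    · intro p _ hp
      rw [if_neg (by omega), if_neg fun h => hp h.1.symm, smul_zero, add_zero, zero_mul, map_zero]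
    · intro h
      exact absurd (mem_range.2 (by omega)) h
  refine Submodule.span_le.2 ?_
  rintro x ⟨u, m, n, rfl⟩
  rcases lt_or_ge m N with h | h
  · exact hsmall m h n u
  · exact hlarge m h n u

theorem exists_matY_ne_zero [Nonempty ι] (hε : IsTwistSign s ε) (hσ : IsAntiInvolution σ) :
    ∃ u ∈ twistSpan s ε σ, ∃ v ∈ twistSpan s ε σ, ∃ j, matY F ι u v j ≠ 0 := by
  by_contra hn
  push Not at hn
  -- If all brackets vanished, `column_mem` with the zero subspace would make the generator with
  -- matrix 1 and exponents (1, 2) zero. Unequal exponents prevent its halves from cancelling.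
  obtain ⟨A, hA⟩ := column_mem hε hσ ⊥ (twistEl_mem s ε σ 1 0 1) fun f hf j =>
    (Submodule.mem_bot F).2 (hn f hf _ (twistEl_mem s ε σ 1 0 1) j)
  have h1 := hA (A + 2) (by omega) 0 (by omega) 2 1
  simp only [shiftCoeff_twistEl] at h1
  rw [sum_eq_single 1] at h1
  · have h2 := congrArg (shiftCoeff F ι s 1 2) ((Submodule.mem_bot F).1 h1)
    rw [shiftCoeff_twistEl] at h2
    simp at h2
  · intro p _ hp
    rw [if_neg (by omega), if_neg (by omega), smul_zero, add_zero, zero_mul, map_zero]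
  · intro h
    exact absurd (mem_range.2 (by omega)) h

theorem isSimple_twistSpan [Nonempty ι] (hε : IsTwistSign s ε) (hσ : IsAntiInvolution σ)
    (h : IsClosedSubspace (matD F ι) (matY F ι) (twistSpan s ε σ)) : IsSimple h.resD h.resY where
  nontrivial := by
    obtain ⟨u, hu, v, hv, j, hj⟩ := exists_matY_ne_zero hε hσ
    refine ⟨⟨u, hu⟩, ⟨v, hv⟩, fun h0 => hj ?_⟩
    have h1 := IsClosedSubspace.resY_coe h ⟨u, hu⟩ ⟨v, hv⟩ j
    rw [h0] at h1
    exact h1.symm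
  ideal I hI := by
    by_cases hb : I = ⊥
    · exact Or.inl hb
    right
    have hJ : I.map (twistSpan s ε σ).subtype ≤ twistSpan s ε σ := Submodule.map_subtype_le _ _
    have hY : ∀ f ∈ twistSpan s ε σ, ∀ g ∈ I.map (twistSpan s ε σ).subtype, ∀ j,
        matY F ι f g j ∈ I.map (twistSpan s ε σ).subtype := by
      rintro f hf _ ⟨g, hg, rfl⟩ j
      exact ⟨_, hI.Y_mem ⟨f, hf⟩ g hg j, rfl⟩
    have hne : I.map (twistSpan s ε σ).subtype ≠ ⊥ := by
      intro h0
      exact hb (Submodule.map_injective_of_injective (Submodule.subtype_injective _)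
        (h0.trans (Submodule.map_bot _).symm))
    have hle : twistSpan s ε σ ≤ I.map (twistSpan s ε σ).subtype := by
      rcases hε with rfl | hε
      · exact twistSpan_le_of_untwisted hσ _ hJ hY hne
      · exact twistSpan_le_of_twisted hσ hε _ hJ hY hne
    refine eq_top_of_twistGen_mem I fun u m n => ?_
    obtain ⟨y, hy, hyx⟩ := hle (twistEl_mem s ε σ m n u)
    rwa [← show y = twistGen s ε σ m n u from Subtype.ext hyx]

end Simple

/-! ### The two anti-involutions and the final assembly -/

section Main

variable {F : Type*} [Field F] [CharZero F] {ι : Type} [Fintype ι] [DecidableEq ι]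

theorem isSimpleSubalgebraOfFiniteGrowth_twistSpan [Nonempty ι] {s : ℕ} {ε : F}
    {σ : Matrix ι ι F →ₗ[F] Matrix ι ι F} (hε : IsTwistSign s ε) (hσ : IsAntiInvolution σ) :
    IsSimpleSubalgebraOfFiniteGrowth (matD F ι) (matY F ι) (matGrading F ι) (twistSpan s ε σ) :=
  let h := isClosedSubspace_twistSpan s hε hσ
  ⟨h, h.isConformalAlgebra isConformalAlgebra_mat, isSimple_twistSpan hε hσ h,
    isFiniteGrowth_twistSpan h⟩

omit [CharZero F] [DecidableEq ι] in
theorem isAntiInvolution_transpose :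
    IsAntiInvolution (Matrix.transposeLinearEquiv ι ι F F).toLinearMap where
  map_mul u v := Matrix.transpose_mul u v
  map_map u := Matrix.transpose_transpose u

/-- The symplectic anti-automorphism as a linear map. -/
def daggerLin (F κ : Type*) [Field F] [Fintype κ] [DecidableEq κ] :
    Matrix (κ ⊕ κ) (κ ⊕ κ) F →ₗ[F] Matrix (κ ⊕ κ) (κ ⊕ κ) F where
  toFun := dagger
  map_add' u v := by simp [dagger, mul_add, add_mul]
  map_smul' a u := by simp [dagger]

variable {κ : Type*} [Fintype κ] [DecidableEq κ]

omit [CharZero F] in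
theorem dagger_fromBlocks (a b c d : Matrix κ κ F) : dagger (Matrix.fromBlocks a b c d) =
    Matrix.fromBlocks d.transpose (-b.transpose) (-c.transpose) a.transpose := by
  simp [dagger, Matrix.fromBlocks_transpose, Matrix.fromBlocks_multiply]

omit [CharZero F] in
theorem isAntiInvolution_daggerLin : IsAntiInvolution (daggerLin F κ) where
  map_mul u v := by
    change dagger (u * v) = dagger v * dagger u
    rw [← Matrix.fromBlocks_toBlocks u, ← Matrix.fromBlocks_toBlocks v]
    simp only [dagger_fromBlocks, Matrix.fromBlocks_multiply, Matrix.transpose_add,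
      Matrix.transpose_mul]
    congr 1 <;> noncomm_ring
  map_map u := by
    change dagger (dagger u) = u
    rw [← Matrix.fromBlocks_toBlocks u]
    simp [dagger_fromBlocks]

end Main

end Conformal

end

theorem theorem4p1 (F : Type*) [Field F] [CharZero F] (ℓ : ℕ) (hℓ : 1 ≤ ℓ) :
    (∀ k : ℕ, 1 ≤ k →
      Conformal.IsConformalAlgebra (Conformal.matD F (Fin k)) (Conformal.matY F (Fin k)) ∧
      (Conformal.IsSimpleSubalgebraOfFiniteGrowth
          (Conformal.matD F (Fin k)) (Conformal.matY F (Fin k)) (Conformal.matGrading F (Fin k))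
          (Conformal.matSub F (Fin k) ℓ) ∧
        Conformal.HasMinimalWeight
          (Conformal.matGrading F (Fin k)) (Conformal.matSub F (Fin k) ℓ) ℓ) ∧
      (Conformal.IsSimpleSubalgebraOfFiniteGrowth
          (Conformal.matD F (Fin k)) (Conformal.matY F (Fin k)) (Conformal.matGrading F (Fin k))
          (Conformal.matStar F (Fin k) ℓ) ∧
        (2 ≤ k ∨ Even ℓ → Conformal.HasMinimalWeight
          (Conformal.matGrading F (Fin k)) (Conformal.matStar F (Fin k) ℓ) ℓ))) ∧
    (∀ k₁ : ℕ, 1 ≤ k₁ →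
      Conformal.IsSimpleSubalgebraOfFiniteGrowth
          (Conformal.matD F (Fin k₁ ⊕ Fin k₁)) (Conformal.matY F (Fin k₁ ⊕ Fin k₁))
          (Conformal.matGrading F (Fin k₁ ⊕ Fin k₁)) (Conformal.matDagger F (Fin k₁) ℓ) ∧
        Conformal.HasMinimalWeight
          (Conformal.matGrading F (Fin k₁ ⊕ Fin k₁)) (Conformal.matDagger F (Fin k₁) ℓ) ℓ) := by
  obtain ⟨s, rfl⟩ : ∃ s, ℓ = s + 1 := ⟨ℓ - 1, by omega⟩
  refine ⟨fun k hk => ?_, fun k hk => ?_⟩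
  · have : Nonempty (Fin k) := ⟨⟨0, hk⟩⟩
    have hsub := Conformal.matSub_eq_twistSpan (F := F)
      (Matrix.transposeLinearEquiv (Fin k) (Fin k) F F).toLinearMap (s + 1)
    have hstar : Conformal.matStar F (Fin k) (s + 1) = Conformal.twistSpan s (-(-1) ^ s)
        (Matrix.transposeLinearEquiv (Fin k) (Fin k) F F).toLinearMap :=
      Conformal.matTwist_eq_twistSpan (Matrix.transposeLinearEquiv (Fin k) (Fin k) F F).toLinearMap
        (s + 1)
    rw [Nat.add_sub_cancel] at hsub
    rw [hsub, hstar]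
    refine ⟨Conformal.isConformalAlgebra_mat,
      ⟨Conformal.isSimpleSubalgebraOfFiniteGrowth_twistSpan (Or.inl rfl)
        Conformal.isAntiInvolution_transpose,
      Conformal.hasMinimalWeight_twistSpan (u := 1) (by simp)⟩,
      Conformal.isSimpleSubalgebraOfFiniteGrowth_twistSpan (Or.inr rfl)
        Conformal.isAntiInvolution_transpose, fun h => ?_⟩
    rcases Nat.even_or_odd s with hs | hs
    -- For s even ε = -1, so a non-symmetric matrix is needed; an off-diagonal matrix unit exists
    -- once k ≥ 2.
    · have hk2 : 2 ≤ k := h.resolve_right fun h => (Nat.even_add_one.1 h) hs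
      refine Conformal.hasMinimalWeight_twistSpan
        (u := Matrix.single ⟨0, hk⟩ ⟨1, hk2⟩ 1) fun h0 => ?_
      have := congrFun (congrFun h0 ⟨0, hk⟩) ⟨1, hk2⟩
      simp [hs.neg_one_pow] at this
    · refine Conformal.hasMinimalWeight_twistSpan (u := 1) fun h0 => ?_
      rw [Conformal.isAntiInvolution_transpose.map_one, hs.neg_one_pow, neg_neg, one_smul] at h0
      have := congrFun (congrFun h0 ⟨0, hk⟩) ⟨0, hk⟩
      simp [one_add_one_eq_two] at this
  · have : Nonempty (Fin k) := ⟨⟨0, hk⟩⟩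
    have hdag : Conformal.matDagger F (Fin k) (s + 1) = Conformal.twistSpan s (-(-1) ^ s)
        (Conformal.daggerLin F (Fin k)) :=
      Conformal.matTwist_eq_twistSpan (Conformal.daggerLin F (Fin k)) (s + 1)
    rw [hdag]
    refine ⟨Conformal.isSimpleSubalgebraOfFiniteGrowth_twistSpan (Or.inr rfl)
        Conformal.isAntiInvolution_daggerLin, ?_⟩
    rcases Nat.even_or_odd s with hs | hs
    -- For ε = -1 this block matrix works for every size, since the symplectic involution negates
    -- it.
    · refine Conformal.hasMinimalWeight_twistSpan (u := Matrix.fromBlocks 0 1 0 0) fun h0 => ?_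
      have hd : Conformal.daggerLin F (Fin k) (Matrix.fromBlocks 0 1 0 0) =
          Matrix.fromBlocks 0 (-1) 0 0 := by
        change Conformal.dagger _ = _
        rw [Conformal.dagger_fromBlocks]
        simp
      rw [hd, hs.neg_one_pow] at h0
      have := congrFun (congrFun h0 (Sum.inl ⟨0, hk⟩)) (Sum.inr ⟨0, hk⟩)
      simp at this
    · refine Conformal.hasMinimalWeight_twistSpan (u := 1) fun h0 => ?_
      rw [Conformal.isAntiInvolution_daggerLin.map_one, hs.neg_one_pow, neg_neg, one_smul] at h0
      have := congrFun (congrFun h0 (Sum.inl ⟨0, hk⟩)) (Sum.inl ⟨0, hk⟩)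
      simp [one_add_one_eq_two] at this
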